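/- Let $1\le M\le K$ and $L\ge 1$ be integers. For each user $m\in\{1,\dots,M\}$ let $\mathbf H_m$ be a random $K\times M$ complex matrix with i.i.d. $\mathcal{CN}(0,1)$ entries (nothing is assumed on the joint law of $\mathbf H_1,\dots,\mathbf H_M$; in particular they may be independent). Let $\mathbf R\succ 0$ be an $M\times M$ Hermitian matrix with eigendecomposition $\mathbf R=\mathbf U\,\mathrm{diag}(\lambda_1,\dots,\lambda_M)\,\mathbf U^{\mathsf H}$, $\mathbf U$ unitary. Let $\mathbf q_m$ be the $m$-th column of $\mathbf P_m(\mathbf P_m^{\mathsf H}\mathbf P_m)^{-1}$ with $\mathbf P_m=\mathbf H_m\mathbf U$, let $\mathbf v_m=\mathbf q_m/\lVert\mathbf q_m\rVert$, let $\mathbf u_m$ be the $m$-th column of $\mathbf U$, and let $\rho_m=|\mathbf v_m^{\mathsf H}\mathbf H_m\mathbf u_m|^2$. For a power budget $p>0$, the communications-centric design, knowing $\rho_1,\dots,\rho_M$, has the sum rate $$\overline{\mathcal R}_c^c(p)=\max\Big\{\sum_{m=1}^M\log_2(1+c_m\rho_m)\;:\;c_m\ge 0,\ \sum_{m=1}^M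 c_m\le p\Big\}.$$ Almost surely, all $\rho_m$ are positive and for every $p>0$ this maximum is attained by water-filling, $c_m^\star=\max\{0,\frac1\upsilon-\frac1{\rho_m}\}$, with $\upsilon>0$ such that $\sum_m c_m^\star=p$ (such an $\upsilon$ exists). The sum ergodic rate $\mathcal R_c^c(p)=\mathbb E\{\overline{\mathcal R}_c^c(p)\}$ is finite for every $p>0$, and, as $p\to\infty$, $$\mathcal R_c^c(p)= M\Big(\log_2 p-\log_2 M+\frac{\psi(K'+1)}{\ln 2}\Big)+o(1),\qquad K'=K-M,$$ where $\psi(x)=\frac{d}{dx}\ln\Gamma(x)$ is the digamma function. The sensing-centric design has the same high-SNR behaviour: if for every $p>0$ the deterministic powers $s_m(p)\ge0$, $\sum_m s_m(p)\le p$, are such that $\mathbf W=\mathbf U\,\mathrm{diag}(\sqrt{s_1(p)},\dots,\sqrt{s_M(p)})$ maximizes $\log_2\det(\mathbf I_M+L\mathbf W^{\mathsf H}\mathbf R\mathbf W)$ over all $\mathbf W\in\mathbb C^{M\times M}$ with $\mathrm{tr}(\mathbf W\mathbf W^{\mathsf H})\le p$, then the sum ergodic rate $\mathcal R_c^s(p)=\mathbb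 E\{\sum_m\log_2(1+s_m(p)\rho_m)\}$ is finite for every $p>0$ and satisfies the same asymptotic formula with error $o(1)$. -/

import Mathlib

open MeasureTheory ProbabilityTheory Filter Topology
open scoped Matrix ComplexOrder NNReal

namespace ISAC

/-- The digamma function `ψ(x) = d/dx ln Γ(x)` on the reals. -/
noncomputable def digamma (x : ℝ) : ℝ := deriv (fun t : ℝ => Real.log (Real.Gamma t)) x

/-- The standard circularly symmetric complex Gaussian law `CN(0,1)`: independent real and
imaginary parts, each centred Gaussian of variance `1/2`. -/
noncomputable def stdComplexGaussian : Measure ℂ :=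
  ((gaussianReal 0 (1 / 2)).prod (gaussianReal 0 (1 / 2))).map
    (fun z : ℝ × ℝ => (⟨z.1, z.2⟩ : ℂ))

/-- Rayleigh fading: the entries of the random matrix `H` are i.i.d. `CN(0,1)`. -/
def IsRayleigh {Ω : Type*} [MeasurableSpace Ω] {K M : ℕ} (μ : Measure Ω)
    (H : Ω → Matrix (Fin K) (Fin M) ℂ) : Prop :=
  (∀ i j, HasLaw (fun ω => H ω i j) stdComplexGaussian μ) ∧
    iIndepFun (fun (ij : Fin K × Fin M) ω => H ω ij.1 ij.2) μ

/-- The `m`-th column `q_m` of `P_m (P_mᴴ P_m)⁻¹`, where `P_m = H P` is the effective channel. -/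
noncomputable def zfColumn {K M : ℕ} (P : Matrix (Fin M) (Fin M) ℂ)
    (H : Matrix (Fin K) (Fin M) ℂ) (m : Fin M) : Fin K → ℂ :=
  ((H * P) * ((H * P)ᴴ * (H * P))⁻¹).col m

/-- The normalized equalizer `v_m = q_m / ‖q_m‖` (Euclidean norm). -/
noncomputable def equalizer {K M : ℕ} (P : Matrix (Fin M) (Fin M) ℂ)
    (H : Matrix (Fin K) (Fin M) ℂ) (m : Fin M) : Fin K → ℂ :=
  ((‖WithLp.toLp 2 (zfColumn P H m)‖⁻¹ : ℝ) : ℂ) • zfColumn P H m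

/-- The effective gain `ρ_m = |v_mᴴ H p_m|²`, where `p_m` is the `m`-th column of `P`. -/
noncomputable def gain {K M : ℕ} (P : Matrix (Fin M) (Fin M) ℂ)
    (H : Matrix (Fin K) (Fin M) ℂ) (m : Fin M) : ℝ :=
  ‖star (equalizer P H m) ⬝ᵥ (H *ᵥ P.col m)‖ ^ 2

/-- The sum communication rate `∑ₘ log₂ (1 + cₘ ρₘ)` for powers `c` and gains `ρ`. -/
noncomputable def sumRate {M : ℕ} (c ρ : Fin M → ℝ) : ℝ :=
  ∑ m, Real.logb 2 (1 + c m * ρ m)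

/-- Power allocations within the budget `p`. -/
def powerBudget (M : ℕ) (p : ℝ) : Set (Fin M → ℝ) :=
  {c | (∀ m, 0 ≤ c m) ∧ ∑ m, c m ≤ p}

/-- The sum rates that are achievable with budget `p` when the gains are `ρ`. -/
def achievableRates {M : ℕ} (p : ℝ) (ρ : Fin M → ℝ) : Set ℝ :=
  (fun c => sumRate c ρ) '' powerBudget M p

/-- The sum rate of the communications-centric design: the maximum achievable sum rate. -/
noncomputable def ccSumRate {M : ℕ} (p : ℝ) (ρ : Fin M → ℝ) : ℝ :=
  sSup (achievableRates p ρ)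

/-- The water-filling allocation `max {0, 1/υ - 1/ρₘ}`. -/
noncomputable def waterFilling {M : ℕ} (υ : ℝ) (ρ : Fin M → ℝ) (m : Fin M) : ℝ :=
  max 0 (1 / υ - 1 / ρ m)

/-- The objective `log₂ det (I + L Wᴴ R W)` of the sensing-centric design. -/
noncomputable def sensingObjective {M : ℕ} (R : Matrix (Fin M) (Fin M) ℂ) (L : ℕ)
    (W : Matrix (Fin M) (Fin M) ℂ) : ℝ :=
  Real.logb 2 (1 + (L : ℂ) • (Wᴴ * R * W)).det.re

/-- The precoder `U diag(√s₁, …, √s_M)`. -/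
noncomputable def precoder {M : ℕ} (U : Matrix (Fin M) (Fin M) ℂ) (s : Fin M → ℝ) :
    Matrix (Fin M) (Fin M) ℂ :=
  U * Matrix.diagonal (fun m => (Real.sqrt (s m) : ℂ))

/-- `s` is a power allocation of the sensing-centric design with budget `p`: the precoder
`U diag(√s)` maximizes the sensing objective over all precoders `W` with `tr (W Wᴴ) ≤ p`. -/
def IsSensingCentric {M : ℕ} (R U : Matrix (Fin M) (Fin M) ℂ) (L : ℕ) (p : ℝ)
    (s : Fin M → ℝ) : Prop :=
  s ∈ powerBudget M p ∧
    IsMaxOn (sensingObjective R L)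
      {W : Matrix (Fin M) (Fin M) ℂ | (W * Wᴴ).trace.re ≤ p} (precoder U s)

/-- The high-SNR expression `M (log₂ p - log₂ M + ψ(K' + 1) / ln 2)` with `K' = K - M`. -/
noncomputable def highSNR (K M : ℕ) (p : ℝ) : ℝ :=
  M * (Real.logb 2 p - Real.logb 2 M + digamma (((K : ℝ) - M) + 1) / Real.log 2)

end ISAC

/-! The gain `ρ m` is the squared distance from the `m`-th column of `H m * U` to the span of the
other columns (`gain_colMatrix_eq`). As `U` is unitary, `H m * U` is again Rayleigh. Given the other
`M - 1` columns, almost surely independent, the distance is the norm of a Gaussian vector projected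
onto a complex subspace of dimension `K' + 1`. So `ρ m` is distributed as `‖w‖ ^ 2`, `w` standard
Gaussian in `ℂ^(K'+1)` (`map_gain_pi_gaussC`): a Gamma law, whose logarithm has mean `Γ'(K'+1) /
Γ(K'+1) = ψ(K'+1)`.

Uniform power bounds the optimal rate below, and concavity of the logarithm bounds it above: after
subtracting `M log₂ (p / M)` it lies between `∑ log₂ ρₘ` and that sum plus `M log₂ (1 + (∑ 1/ρₘ) /
p)`. Dominated convergence gives the limit of the mean. Only marginal laws enter, so the joint law
of the users is irrelevant.

A sensing-optimal allocation does at least as well as uniform power for the sensing objective. This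
alone forces every `s p m → ∞` and `∑ log₂ (s p m) ≥ M log₂ (p / M) - o(1)`; the optimal
communication rate is the matching upper bound. -/

namespace ISAC

/-! ### Optimality of water-filling. -/

section WaterFilling

variable {M : ℕ}

lemma exists_sum_waterFilling_eq (hM : 1 ≤ M) {ρ : Fin M → ℝ} (hρ : ∀ m, 0 < ρ m) {p : ℝ}
    (hp : 0 < p) : ∃ υ : ℝ, 0 < υ ∧ ∑ m, waterFilling υ ρ m = p := by
  let f : ℝ → ℝ := fun t => ∑ m, max 0 (t - 1 / ρ m)
  have hf : Continuous f := by fun_prop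
  have hinv : ∀ m, 0 < 1 / ρ m := fun m => one_div_pos.mpr (hρ m)
  have h0 : f 0 = 0 :=
    Finset.sum_eq_zero fun m _ => max_eq_left (by linarith [hinv m])
  let i : Fin M := ⟨0, hM⟩
  have h1 : p ≤ f (p + 1 / ρ i) := by
    calc p ≤ max 0 (p + 1 / ρ i - 1 / ρ i) := by rw [add_sub_cancel_right]; exact le_max_right _ _
      _ ≤ f (p + 1 / ρ i) := Finset.single_le_sum (f := fun m => max 0 (p + 1 / ρ i - 1 / ρ m))
          (fun m _ => le_max_left _ _) (Finset.mem_univ i)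
  obtain ⟨t, ht, hft⟩ := intermediate_value_Icc (add_pos hp (hinv i)).le hf.continuousOn
    ⟨h0.symm ▸ hp.le, h1⟩
  have ht0 : 0 < t := lt_of_le_of_ne ht.1 fun h => by
    rw [← h, h0] at hft
    exact hp.ne hft
  exact ⟨1 / t, one_div_pos.mpr ht0, by simpa [waterFilling, f] using hft⟩

lemma waterFilling_nonneg (υ : ℝ) (ρ : Fin M → ℝ) (m : Fin M) : 0 ≤ waterFilling υ ρ m :=
  le_max_left _ _

/-- The KKT conditions in tangent form: at the water-filling power the slope of `ln (1 + c ρ)` is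
`υ` if that power is positive and at most `υ` if it vanishes, where `c` can only increase. Summed
over users, the right-hand sides measure unused budget. -/
lemma logb_one_add_sub_le_waterFilling {υ : ℝ} (hυ : 0 < υ) {ρ : Fin M → ℝ} (m : Fin M)
    (hρ : 0 < ρ m) {c : ℝ} (hc : 0 ≤ c) :
    Real.logb 2 (1 + c * ρ m) - Real.logb 2 (1 + waterFilling υ ρ m * ρ m)
      ≤ υ * (c - waterFilling υ ρ m) / Real.log 2 := by
  have hl : 0 < Real.log 2 := Real.log_pos one_lt_two
  have hw := waterFilling_nonneg υ ρ m
  set w := waterFilling υ ρ m with hwdef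
  have hx : 0 < 1 + c * ρ m := by positivity
  have hy : 0 < 1 + w * ρ m := by positivity
  rw [Real.logb, Real.logb, ← sub_div]
  gcongr
  rw [← Real.log_div hx.ne' hy.ne']
  refine (Real.log_le_sub_one_of_pos (div_pos hx hy)).trans ?_
  have : (1 + c * ρ m) / (1 + w * ρ m) - 1 = ρ m / (1 + w * ρ m) * (c - w) := by
    field_simp
    ring
  rw [this]
  rcases le_total 0 (1 / υ - 1 / ρ m) with h | h
  · have hw' : w = 1 / υ - 1 / ρ m := max_eq_right h
    have : ρ m / (1 + w * ρ m) = υ := by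
      rw [hw', sub_mul, one_div_mul_cancel hρ.ne', add_sub_cancel]
      field_simp
    rw [this]
  · have hw' : w = 0 := max_eq_left h
    rw [hw']
    simp only [zero_mul, add_zero, div_one, sub_zero]
    have : ρ m ≤ υ := (one_div_le_one_div hυ hρ).1 (by linarith)
    gcongr

lemma isGreatest_sumRate_waterFilling {ρ : Fin M → ℝ} (hρ : ∀ m, 0 < ρ m) {p υ : ℝ}
    (hυ : 0 < υ) (h : ∑ m, waterFilling υ ρ m = p) :
    IsGreatest (achievableRates p ρ) (sumRate (waterFilling υ ρ) ρ) := by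
  refine ⟨⟨_, ⟨waterFilling_nonneg υ ρ, h.le⟩, rfl⟩, ?_⟩
  rintro _ ⟨c, ⟨hc, hcp⟩, rfl⟩
  rw [← sub_nonpos]
  simp only [sumRate]
  rw [← Finset.sum_sub_distrib]
  calc _ ≤ ∑ m, υ * (c m - waterFilling υ ρ m) / Real.log 2 :=
        Finset.sum_le_sum fun m _ => logb_one_add_sub_le_waterFilling hυ m (hρ m) (hc m)
    _ = υ * (∑ m, c m - p) / Real.log 2 := by
        rw [← Finset.sum_div, ← Finset.mul_sum, Finset.sum_sub_distrib, h]
    _ ≤ 0 := div_nonpos_of_nonpos_of_nonneg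
        (mul_nonpos_of_nonneg_of_nonpos hυ.le (by linarith)) (Real.log_pos one_lt_two).le

end WaterFilling

/-! ### Two-sided bounds on the optimal rate for fixed gains. -/

section RateBounds

variable {M : ℕ}

/-- Jensen's inequality (AM-GM), from the tangent line of `log` at the mean. -/
lemma sum_logb_le_mul_logb_average (hM : 1 ≤ M) {x : Fin M → ℝ} (hx : ∀ m, 0 < x m) :
    ∑ m, Real.logb 2 (x m) ≤ M * Real.logb 2 ((∑ m, x m) / M) := by
  have hl : 0 < Real.log 2 := Real.log_pos one_lt_two
  have hM' : (0 : ℝ) < M := by exact_mod_cast hM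
  have : Nonempty (Fin M) := ⟨⟨0, hM⟩⟩
  set a := (∑ m, x m) / M with ha
  have hs : 0 < ∑ m, x m := Finset.sum_pos (fun m _ => hx m) Finset.univ_nonempty
  have ha0 : 0 < a := by positivity
  have key : ∀ m, Real.log (x m) ≤ Real.log a + (x m / a - 1) := fun m => by
    have := Real.log_le_sub_one_of_pos (div_pos (hx m) ha0)
    rw [Real.log_div (hx m).ne' ha0.ne'] at this
    linarith
  have : ∑ m, Real.log (x m) ≤ M * Real.log a := by
    refine (Finset.sum_le_sum fun m _ => key m).trans_eq ?_
    rw [Finset.sum_add_distrib, Finset.sum_sub_distrib, ← Finset.sum_div]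
    have : (∑ m, x m) / a = M := by rw [ha]; field_simp
    rw [this]
    simp
  simp only [Real.logb]
  rw [← Finset.sum_div, ← mul_div_assoc]
  gcongr

lemma sumRate_nonneg {c ρ : Fin M → ℝ} (hc : ∀ m, 0 ≤ c m) (hρ : ∀ m, 0 ≤ ρ m) :
    0 ≤ sumRate c ρ :=
  Finset.sum_nonneg fun m _ => Real.logb_nonneg one_lt_two
    (le_add_of_nonneg_right (mul_nonneg (hc m) (hρ m)))

lemma sumRate_mono {c d ρ : Fin M → ℝ} (hc : ∀ m, 0 ≤ c m) (hcd : ∀ m, c m ≤ d m)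
    (hρ : ∀ m, 0 ≤ ρ m) : sumRate c ρ ≤ sumRate d ρ := by
  refine Finset.sum_le_sum fun m _ => Real.logb_le_logb_of_le one_lt_two ?_ ?_
  · have := mul_nonneg (hc m) (hρ m)
    linarith
  · have := mul_le_mul_of_nonneg_right (hcd m) (hρ m)
    linarith

lemma le_budget {p : ℝ} {c : Fin M → ℝ} (hc : c ∈ powerBudget M p) (m : Fin M) : c m ≤ p :=
  (Finset.single_le_sum (fun i _ => hc.1 i) (Finset.mem_univ m)).trans hc.2

lemma sumRate_le_of_mem_powerBudget {p : ℝ} {c ρ : Fin M → ℝ} (hc : c ∈ powerBudget M p)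
    (hρ : ∀ m, 0 ≤ ρ m) : sumRate c ρ ≤ sumRate (fun _ => p) ρ :=
  sumRate_mono hc.1 (le_budget hc) hρ

lemma bddAbove_achievableRates (p : ℝ) {ρ : Fin M → ℝ} (hρ : ∀ m, 0 ≤ ρ m) :
    BddAbove (achievableRates p ρ) := by
  refine ⟨sumRate (fun _ => p) ρ, ?_⟩
  rintro _ ⟨c, hc, rfl⟩
  exact sumRate_le_of_mem_powerBudget hc hρ

lemma sumRate_le_ccSumRate {p : ℝ} {c ρ : Fin M → ℝ} (hc : c ∈ powerBudget M p)
    (hρ : ∀ m, 0 ≤ ρ m) : sumRate c ρ ≤ ccSumRate p ρ :=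
  le_csSup (bddAbove_achievableRates p hρ) ⟨c, hc, rfl⟩

lemma zero_mem_powerBudget {p : ℝ} (hp : 0 ≤ p) : (0 : Fin M → ℝ) ∈ powerBudget M p :=
  ⟨fun _ => le_rfl, by simpa using hp⟩

lemma ccSumRate_le_of_forall {p b : ℝ} (hp : 0 ≤ p) {ρ : Fin M → ℝ}
    (h : ∀ c ∈ powerBudget M p, sumRate c ρ ≤ b) : ccSumRate p ρ ≤ b := by
  refine csSup_le ⟨_, 0, zero_mem_powerBudget hp, rfl⟩ ?_
  rintro _ ⟨c, hc, rfl⟩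
  exact h c hc

lemma ccSumRate_nonneg {p : ℝ} (hp : 0 ≤ p) {ρ : Fin M → ℝ} (hρ : ∀ m, 0 ≤ ρ m) :
    0 ≤ ccSumRate p ρ :=
  (sumRate_nonneg (fun _ => le_rfl) hρ).trans (sumRate_le_ccSumRate (zero_mem_powerBudget hp) hρ)

lemma const_mem_powerBudget (hM : 1 ≤ M) {p : ℝ} (hp : 0 ≤ p) :
    (fun _ => p / M) ∈ powerBudget M p := by
  have hM' : (0 : ℝ) < M := by exact_mod_cast hM
  refine ⟨fun _ => by positivity, le_of_eq ?_⟩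
  simp
  field_simp

/-- Uniform power `p / M`, with the `1` inside each logarithm dropped. -/
lemma sum_logb_le_ccSumRate_sub (hM : 1 ≤ M) {p : ℝ} (hp : 0 < p) {ρ : Fin M → ℝ}
    (hρ : ∀ m, 0 < ρ m) :
    ∑ m, Real.logb 2 (ρ m) ≤ ccSumRate p ρ - M * Real.logb 2 (p / M) := by
  have hM' : (0 : ℝ) < M := by exact_mod_cast hM
  have hq : 0 < p / M := by positivity
  rw [le_sub_iff_add_le]
  refine le_trans ?_ (sumRate_le_ccSumRate (const_mem_powerBudget hM hp.le) fun m => (hρ m).le)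
  have : (M : ℝ) * Real.logb 2 (p / M) = ∑ _m : Fin M, Real.logb 2 (p / M) := by simp
  rw [this, ← Finset.sum_add_distrib]
  refine Finset.sum_le_sum fun m _ => ?_
  rw [← Real.logb_mul (hρ m).ne' hq.ne']
  have := mul_pos (hρ m) hq
  exact Real.logb_le_logb_of_le one_lt_two this (by rw [mul_comm]; linarith)

/-- Factoring `1 + c ρ = ρ (1/ρ + c)` isolates `∑ log₂ ρₘ`; AM-GM on the remaining factors involves
`c` only through its sum, which is at most `p`. -/
lemma ccSumRate_sub_le (hM : 1 ≤ M) {p : ℝ} (hp : 0 < p) {ρ : Fin M → ℝ}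
    (hρ : ∀ m, 0 < ρ m) :
    ccSumRate p ρ - M * Real.logb 2 (p / M)
      ≤ ∑ m, Real.logb 2 (ρ m) + M * Real.logb 2 (1 + (∑ m, 1 / ρ m) / p) := by
  have hM' : (0 : ℝ) < M := by exact_mod_cast hM
  have hs : 0 ≤ ∑ m, 1 / ρ m := Finset.sum_nonneg fun m _ => (one_div_pos.mpr (hρ m)).le
  rw [sub_le_iff_le_add]
  refine ccSumRate_le_of_forall hp.le fun c hc => ?_
  have hpos : ∀ m, 0 < 1 / ρ m + c m := fun m =>
    add_pos_of_pos_of_nonneg (one_div_pos.mpr (hρ m)) (hc.1 m)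
  have h1 : sumRate c ρ = ∑ m, Real.logb 2 (ρ m) + ∑ m, Real.logb 2 (1 / ρ m + c m) := by
    rw [sumRate, ← Finset.sum_add_distrib]
    refine Finset.sum_congr rfl fun m _ => ?_
    rw [← Real.logb_mul (hρ m).ne' (hpos m).ne']
    congr 1
    have := (hρ m).ne'
    field_simp
  rw [h1, add_assoc]
  gcongr
  refine (sum_logb_le_mul_logb_average hM hpos).trans ?_
  rw [← mul_add, ← Real.logb_mul (by positivity) (by positivity)]
  have : Nonempty (Fin M) := ⟨⟨0, hM⟩⟩
  have h2 : 0 < ∑ m, (1 / ρ m + c m) := Finset.sum_pos (fun m _ => hpos m) Finset.univ_nonempty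
  gcongr
  · norm_num
  · rw [Finset.sum_add_distrib]
    have := hc.2
    have h3 : (1 + (∑ m, 1 / ρ m) / p) * (p / M) = (∑ m, 1 / ρ m + p) / M := by
      field_simp
      ring
    rw [h3]
    gcongr

end RateBounds

/-! ### Ergodic rates as the power tends to infinity, for gains with integrable logarithms. -/

section Asymptotics

variable {Ω : Type*} [MeasurableSpace Ω] {μ : Measure Ω} {M : ℕ}

lemma aemeasurable_ccSumRate {ρ : Ω → Fin M → ℝ} (hρ : ∀ m, AEMeasurable (fun ω => ρ ω m) μ)
    (hnn : ∀ ω m, 0 ≤ ρ ω m) (p : ℝ) : AEMeasurable (fun ω => ccSumRate p (ρ ω)) μ := by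
  have hK : IsCompact (powerBudget M p) := by
    refine Metric.isCompact_of_isClosed_isBounded ?_ ?_
    · have h : powerBudget M p = (⋂ m, {c | 0 ≤ c m}) ∩ {c | ∑ m, c m ≤ p} := by
        ext c
        simp [powerBudget]
      rw [h]
      exact (isClosed_iInter fun m => isClosed_le continuous_const (continuous_apply m)).inter
        (isClosed_le (by fun_prop) continuous_const)
    · refine (Metric.isBounded_Icc (0 : Fin M → ℝ) fun _ => p).subset fun c hc => ?_
      exact ⟨hc.1, le_budget hc⟩
  -- The absolute values change nothing on the relevant domain and make the rate jointly continuous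
  -- everywhere, so its supremum over the compact budget set is continuous in the gains.
  let f : (Fin M → ℝ) → (Fin M → ℝ) → ℝ := fun x c => ∑ m, Real.logb 2 (1 + |c m| * |x m|)
  have hf : Continuous ↿f := by
    change Continuous fun x : (Fin M → ℝ) × (Fin M → ℝ) =>
      ∑ m, Real.logb 2 (1 + |x.2 m| * |x.1 m|)
    refine continuous_finsetSum _ fun m _ => ?_
    refine Continuous.div_const (Continuous.log (by fun_prop) fun x => ?_) _
    positivity
  have hcont := hK.continuous_sSup hf
  have heq : (fun ω => ccSumRate p (ρ ω)) = (fun x => sSup (f x '' powerBudget M p)) ∘ ρ := by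
    funext ω
    simp only [ccSumRate, achievableRates, Function.comp_apply]
    congr 1
    refine Set.image_congr fun c hc => Finset.sum_congr rfl fun m _ => ?_
    rw [abs_of_nonneg (hc.1 m), abs_of_nonneg (hnn ω m)]
  rw [heq]
  exact hcont.measurable.comp_aemeasurable (aemeasurable_pi_lambda _ hρ)

lemma integrable_logb_one_add_mul [IsFiniteMeasure μ] {X : Ω → ℝ} (hX : AEMeasurable X μ)
    (hnn : ∀ ω, 0 ≤ X ω)
    (hint : Integrable (fun ω => Real.logb 2 (1 + X ω)) μ) {c : ℝ} (hc : 0 ≤ c) :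
    Integrable (fun ω => Real.logb 2 (1 + c * X ω)) μ := by
  refine Integrable.mono' ((integrable_const (Real.logb 2 (1 + c))).add hint) ?_ ?_
  · exact (((hX.const_mul c).const_add 1).log.div_const _).aestronglyMeasurable
  · refine Eventually.of_forall fun ω => ?_
    have hx := hnn ω
    have h1 : (1 : ℝ) ≤ 1 + c * X ω := le_add_of_nonneg_right (mul_nonneg hc hx)
    rw [Real.norm_of_nonneg (Real.logb_nonneg one_lt_two h1)]
    simp only [Pi.add_apply]
    rw [← Real.logb_mul (by positivity) (by positivity)]
    refine Real.logb_le_logb_of_le one_lt_two (by linarith) ?_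
    nlinarith [mul_nonneg hc hx]

lemma integrable_sumRate [IsFiniteMeasure μ] {ρ : Ω → Fin M → ℝ}
    (hρ : ∀ m, AEMeasurable (fun ω => ρ ω m) μ) (hnn : ∀ ω m, 0 ≤ ρ ω m)
    (hint : ∀ m, Integrable (fun ω => Real.logb 2 (1 + ρ ω m)) μ) {c : Fin M → ℝ}
    (hc : ∀ m, 0 ≤ c m) : Integrable (fun ω => sumRate c (ρ ω)) μ :=
  integrable_finsetSum _ fun m _ =>
    integrable_logb_one_add_mul (hρ m) (fun ω => hnn ω m) (hint m) (hc m)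

lemma integrable_ccSumRate [IsFiniteMeasure μ] {ρ : Ω → Fin M → ℝ}
    (hρ : ∀ m, AEMeasurable (fun ω => ρ ω m) μ) (hnn : ∀ ω m, 0 ≤ ρ ω m)
    (hint : ∀ m, Integrable (fun ω => Real.logb 2 (1 + ρ ω m)) μ) {p : ℝ}
    (hp : 0 < p) : Integrable (fun ω => ccSumRate p (ρ ω)) μ := by
  refine Integrable.mono' (integrable_sumRate hρ hnn hint (c := fun _ => p) fun _ => hp.le)
    (aemeasurable_ccSumRate hρ hnn p).aestronglyMeasurable (Eventually.of_forall fun ω => ?_)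
  rw [Real.norm_of_nonneg (ccSumRate_nonneg hp.le (hnn ω))]
  exact ccSumRate_le_of_forall hp.le fun c hc => sumRate_le_of_mem_powerBudget hc (hnn ω)

lemma one_add_sum_le_prod_one_add {ι : Type*} (s : Finset ι) {x : ι → ℝ} (hx : ∀ i, 0 ≤ x i) :
    1 + ∑ i ∈ s, x i ≤ ∏ i ∈ s, (1 + x i) := by
  classical
  induction s using Finset.induction_on with
  | empty => simp
  | insert a s ha ih =>
    rw [Finset.sum_insert ha, Finset.prod_insert ha]
    have h1 : 0 ≤ ∑ i ∈ s, x i := Finset.sum_nonneg fun i _ => hx i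
    nlinarith [hx a, mul_nonneg (hx a) h1]

/-- Provides the dominating function. The bound is logarithmic in `1 / ρ m` because `1 / ρ m` itself
is not integrable when `K = M`. -/
lemma logb_one_add_sum_inv_le {ρ : Fin M → ℝ} (hρ : ∀ m, 0 < ρ m) :
    Real.logb 2 (1 + ∑ m, 1 / ρ m) ≤ ∑ m, (Real.logb 2 (1 + ρ m) - Real.logb 2 (ρ m)) := by
  have hinv : ∀ m, 0 ≤ 1 / ρ m := fun m => (one_div_pos.mpr (hρ m)).le
  have hs : 0 ≤ ∑ m, 1 / ρ m := Finset.sum_nonneg fun m _ => hinv m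
  refine (Real.logb_le_logb_of_le one_lt_two (by positivity)
    (one_add_sum_le_prod_one_add Finset.univ hinv)).trans_eq ?_
  have hne : ∀ m ∈ Finset.univ, 1 + 1 / ρ m ≠ 0 := fun m _ => by
    have := hinv m
    positivity
  rw [Real.logb, Real.log_prod hne, Finset.sum_div]
  refine Finset.sum_congr rfl fun m _ => ?_
  have h1 : 0 < ρ m := hρ m
  rw [← Real.logb, ← Real.logb_div (by positivity) h1.ne']
  congr 1
  field_simp
  ring

lemma tendsto_integral_ccSumRate [IsFiniteMeasure μ] (hM : 1 ≤ M) {ρ : Ω → Fin M → ℝ}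
    (hρ : ∀ m, AEMeasurable (fun ω => ρ ω m) μ) (hnn : ∀ ω m, 0 ≤ ρ ω m)
    (hpos : ∀ᵐ ω ∂μ, ∀ m, 0 < ρ ω m)
    (hint : ∀ m, Integrable (fun ω => Real.logb 2 (1 + ρ ω m)) μ)
    (hlog : ∀ m, Integrable (fun ω => Real.logb 2 (ρ ω m)) μ) :
    Tendsto (fun p : ℝ => ∫ ω, (ccSumRate p (ρ ω) - M * Real.logb 2 (p / M)) ∂μ) atTop
      (𝓝 (∫ ω, ∑ m, Real.logb 2 (ρ ω m) ∂μ)) := by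
  have hlogsum : Integrable (fun ω => ∑ m, Real.logb 2 (ρ ω m)) μ :=
    integrable_finsetSum _ fun m _ => hlog m
  refine tendsto_integral_filter_of_dominated_convergence
    (fun ω => |∑ m, Real.logb 2 (ρ ω m)| +
      M * ∑ m, (Real.logb 2 (1 + ρ ω m) - Real.logb 2 (ρ ω m))) ?_ ?_ ?_ ?_
  · exact Eventually.of_forall fun p =>
      ((aemeasurable_ccSumRate hρ hnn p).sub_const _).aestronglyMeasurable
  -- For `p ≥ 1` the correction `(∑ 1/ρₘ) / p` is at most `∑ 1/ρₘ`, which removes `p` from the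
  -- bound.
  · filter_upwards [eventually_ge_atTop 1] with p hp
    filter_upwards [hpos] with ω hω
    have hp0 : 0 < p := by linarith
    have h1 := sum_logb_le_ccSumRate_sub hM hp0 hω
    have h2 := ccSumRate_sub_le hM hp0 hω
    have hs : 0 ≤ ∑ m, 1 / ρ ω m := Finset.sum_nonneg fun m _ => (one_div_pos.mpr (hω m)).le
    have h3 : Real.logb 2 (1 + (∑ m, 1 / ρ ω m) / p)
        ≤ ∑ m, (Real.logb 2 (1 + ρ ω m) - Real.logb 2 (ρ ω m)) := by
      refine le_trans (Real.logb_le_logb_of_le one_lt_two (by positivity) ?_)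
        (logb_one_add_sum_inv_le hω)
      gcongr
      exact div_le_self hs hp
    have h4 : (M : ℝ) * Real.logb 2 (1 + (∑ m, 1 / ρ ω m) / p)
        ≤ M * ∑ m, (Real.logb 2 (1 + ρ ω m) - Real.logb 2 (ρ ω m)) := by gcongr
    have h5 : (0 : ℝ) ≤ M * Real.logb 2 (1 + (∑ m, 1 / ρ ω m) / p) :=
      mul_nonneg (Nat.cast_nonneg _) (Real.logb_nonneg one_lt_two (by
        have : 0 ≤ (∑ m, 1 / ρ ω m) / p := by positivity
        linarith))
    rw [Real.norm_eq_abs, abs_le]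
    constructor
    · linarith [neg_abs_le (∑ m, Real.logb 2 (ρ ω m))]
    · linarith [le_abs_self (∑ m, Real.logb 2 (ρ ω m))]
  · exact hlogsum.abs.add ((integrable_finsetSum _ fun m _ => (hint m).sub (hlog m)).const_mul _)
  · filter_upwards [hpos] with ω hω
    have hlim : Tendsto (fun p : ℝ => ∑ m, Real.logb 2 (ρ ω m) +
        M * Real.logb 2 (1 + (∑ m, 1 / ρ ω m) / p)) atTop
        (𝓝 (∑ m, Real.logb 2 (ρ ω m) + M * Real.logb 2 (1 + 0))) := by
      refine Tendsto.const_add _ (Tendsto.const_mul _ ?_)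
      refine Tendsto.div_const (Tendsto.log ?_ (by norm_num)) _
      exact (tendsto_const_nhds.div_atTop tendsto_id).const_add _
    simp only [add_zero, Real.logb_one, mul_zero] at hlim
    refine tendsto_of_tendsto_of_tendsto_of_le_of_le' tendsto_const_nhds hlim ?_ ?_
    · filter_upwards [eventually_gt_atTop 0] with p hp using sum_logb_le_ccSumRate_sub hM hp hω
    · filter_upwards [eventually_gt_atTop 0] with p hp using ccSumRate_sub_le hM hp hω

lemma tendsto_integral_ccSumRate_sub [IsProbabilityMeasure μ] (hM : 1 ≤ M) {ρ : Ω → Fin M → ℝ}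
    (hρ : ∀ m, AEMeasurable (fun ω => ρ ω m) μ) (hnn : ∀ ω m, 0 ≤ ρ ω m)
    (hpos : ∀ᵐ ω ∂μ, ∀ m, 0 < ρ ω m)
    (hint : ∀ m, Integrable (fun ω => Real.logb 2 (1 + ρ ω m)) μ)
    (hlog : ∀ m, Integrable (fun ω => Real.logb 2 (ρ ω m)) μ) :
    Tendsto (fun p : ℝ => ∫ ω, ccSumRate p (ρ ω) ∂μ -
      (M * Real.logb 2 (p / M) + ∑ m, ∫ ω, Real.logb 2 (ρ ω m) ∂μ)) atTop (𝓝 0) := by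
  have h := tendsto_integral_ccSumRate hM hρ hnn hpos hint hlog
  rw [integral_finsetSum _ fun m _ => hlog m] at h
  have h' := h.sub_const (∑ m, ∫ ω, Real.logb 2 (ρ ω m) ∂μ)
  rw [sub_self] at h'
  refine h'.congr' ?_
  filter_upwards [eventually_gt_atTop 0] with p hp
  rw [integral_sub (integrable_ccSumRate hρ hnn hint hp) (integrable_const _)]
  simp
  ring

/-- A squeeze: from below by `log₂ (1 + s ρ) ≥ log₂ s + log₂ ρ`, from above by the optimal rate. -/
lemma tendsto_integral_sumRate_sub [IsProbabilityMeasure μ] (hM : 1 ≤ M) {ρ : Ω → Fin M → ℝ}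
    (hρ : ∀ m, AEMeasurable (fun ω => ρ ω m) μ) (hnn : ∀ ω m, 0 ≤ ρ ω m)
    (hpos : ∀ᵐ ω ∂μ, ∀ m, 0 < ρ ω m)
    (hint : ∀ m, Integrable (fun ω => Real.logb 2 (1 + ρ ω m)) μ)
    (hlog : ∀ m, Integrable (fun ω => Real.logb 2 (ρ ω m)) μ)
    {s : ℝ → Fin M → ℝ} (hs : ∀ p, 0 < p → s p ∈ powerBudget M p) {ε : ℝ → ℝ}
    (hε : Tendsto ε atTop (𝓝 0)) (hspos : ∀ᶠ p in atTop, ∀ m, 0 < s p m)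
    (hslog : ∀ᶠ p in atTop, M * Real.logb 2 (p / M) - ε p ≤ ∑ m, Real.logb 2 (s p m)) :
    Tendsto (fun p : ℝ => ∫ ω, sumRate (s p) (ρ ω) ∂μ -
      (M * Real.logb 2 (p / M) + ∑ m, ∫ ω, Real.logb 2 (ρ ω m) ∂μ)) atTop (𝓝 0) := by
  refine tendsto_of_tendsto_of_tendsto_of_le_of_le' (by simpa using hε.neg)
    (tendsto_integral_ccSumRate_sub hM hρ hnn hpos hint hlog) ?_ ?_
  · filter_upwards [hspos, hslog, eventually_gt_atTop 0] with p h1 h2 hp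
    have h3 : ∑ m, Real.logb 2 (s p m) + ∑ m, ∫ ω, Real.logb 2 (ρ ω m) ∂μ
        ≤ ∫ ω, sumRate (s p) (ρ ω) ∂μ := by
      have : ∑ m, Real.logb 2 (s p m) + ∑ m, ∫ ω, Real.logb 2 (ρ ω m) ∂μ
          = ∫ ω, (∑ m, Real.logb 2 (s p m) + ∑ m, Real.logb 2 (ρ ω m)) ∂μ := by
        rw [integral_add (integrable_const _) (integrable_finsetSum _ fun m _ => hlog m),
          integral_finsetSum _ fun m _ => hlog m]
        simp
      rw [this]
      refine integral_mono_ae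
        ((integrable_const _).add (integrable_finsetSum _ fun m _ => hlog m))
        (integrable_sumRate hρ hnn hint fun m => (h1 m).le) ?_
      filter_upwards [hpos] with ω hω
      rw [← Finset.sum_add_distrib]
      refine Finset.sum_le_sum fun m _ => ?_
      rw [← Real.logb_mul (h1 m).ne' (hω m).ne']
      exact Real.logb_le_logb_of_le one_lt_two (mul_pos (h1 m) (hω m)) (by linarith)
    linarith
  · filter_upwards [eventually_gt_atTop 0] with p hp
    gcongr
    · exact integrable_sumRate hρ hnn hint (hs p hp).1
    · exact integrable_ccSumRate hρ hnn hint hp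
    · exact Pi.le_def.2 fun ω => sumRate_le_ccSumRate (hs p hp) (hnn ω)

end Asymptotics

/-! ### Sensing-optimal power allocations at high power. -/

section Sensing

variable {M : ℕ}

lemma conjTranspose_precoder (U : Matrix (Fin M) (Fin M) ℂ) (s : Fin M → ℝ) :
    (precoder U s)ᴴ = Matrix.diagonal (fun m => (Real.sqrt (s m) : ℂ)) * Uᴴ := by
  rw [precoder, Matrix.conjTranspose_mul, Matrix.diagonal_conjTranspose]
  congr 2
  funext m
  simp

lemma trace_precoder {U : Matrix (Fin M) (Fin M) ℂ} (hU : U ∈ Matrix.unitaryGroup (Fin M) ℂ)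
    {s : Fin M → ℝ} (hs : ∀ m, 0 ≤ s m) :
    (precoder U s * (precoder U s)ᴴ).trace.re = ∑ m, s m := by
  have hU' : Uᴴ * U = 1 := Matrix.mem_unitaryGroup_iff'.1 hU
  rw [Matrix.trace_mul_comm, conjTranspose_precoder, precoder, Matrix.mul_assoc,
    ← Matrix.mul_assoc Uᴴ, hU', Matrix.one_mul, Matrix.diagonal_mul_diagonal,
    Matrix.trace_diagonal, Complex.re_sum]
  refine Finset.sum_congr rfl fun m _ => ?_
  rw [← Complex.ofReal_mul, Real.mul_self_sqrt (hs m), Complex.ofReal_re]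

lemma eigenvalue_pos {R U : Matrix (Fin M) (Fin M) ℂ} (hR : R.PosDef)
    (hU : U ∈ Matrix.unitaryGroup (Fin M) ℂ) {lam : Fin M → ℝ}
    (hlam : R = U * Matrix.diagonal (fun m => (lam m : ℂ)) * Uᴴ) (m : Fin M) : 0 < lam m := by
  have hU' : Uᴴ * U = 1 := Matrix.mem_unitaryGroup_iff'.1 hU
  have hinj : Function.Injective U.mulVec := Function.LeftInverse.injective (g := Uᴴ.mulVec)
    fun x => by rw [Matrix.mulVec_mulVec, hU', Matrix.one_mulVec]
  have h := hR.conjTranspose_mul_mul_same hinj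
  have h2 : Uᴴ * R * U = Matrix.diagonal (fun m => (lam m : ℂ)) := by
    rw [hlam, Matrix.mul_assoc, Matrix.mul_assoc _ Uᴴ, hU', Matrix.mul_one, ← Matrix.mul_assoc, hU',
      Matrix.one_mul]
  rw [h2, Matrix.posDef_diagonal_iff] at h
  exact_mod_cast h m

lemma sensingObjective_precoder {R U : Matrix (Fin M) (Fin M) ℂ}
    (hU : U ∈ Matrix.unitaryGroup (Fin M) ℂ) {lam : Fin M → ℝ}
    (hlam : R = U * Matrix.diagonal (fun m => (lam m : ℂ)) * Uᴴ)
    (hpos : ∀ m, 0 < lam m) (L : ℕ) {s : Fin M → ℝ} (hs : ∀ m, 0 ≤ s m) :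
    sensingObjective R L (precoder U s) = ∑ m, Real.logb 2 (1 + L * lam m * s m) := by
  have hU' : Uᴴ * U = 1 := Matrix.mem_unitaryGroup_iff'.1 hU
  have h1 : (precoder U s)ᴴ * R * precoder U s
      = Matrix.diagonal (fun m => ((lam m * s m : ℝ) : ℂ)) := by
    rw [conjTranspose_precoder, precoder, hlam]
    have : ∀ D E : Matrix (Fin M) (Fin M) ℂ,
        D * Uᴴ * (U * E * Uᴴ) * (U * D) = D * (Uᴴ * U) * E * (Uᴴ * U) * D := fun D E => by
      simp only [Matrix.mul_assoc]
    rw [this, hU']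
    simp only [Matrix.mul_one, Matrix.diagonal_mul_diagonal]
    congr 1
    funext m
    rw [mul_comm, ← mul_assoc, ← Complex.ofReal_mul, Real.mul_self_sqrt (hs m), mul_comm,
      ← Complex.ofReal_mul]
  have h2 : (1 + (L : ℂ) • Matrix.diagonal (fun m => ((lam m * s m : ℝ) : ℂ)))
      = Matrix.diagonal (fun m => ((1 + L * lam m * s m : ℝ) : ℂ)) := by
    rw [← Matrix.diagonal_one, ← Matrix.diagonal_smul, Matrix.diagonal_add]
    congr 1
    funext m
    simp [mul_assoc]
  rw [sensingObjective, h1, h2, Matrix.det_diagonal, ← Complex.ofReal_prod, Complex.ofReal_re,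
    Real.logb, Real.log_prod, Finset.sum_div]
  · rfl
  · intro m _
    have := hs m
    have := hpos m
    positivity

/-- The only consequence of sensing optimality that is needed: comparison with the uniform precoder.
-/
lemma IsSensingCentric.sum_logb_le (hM : 1 ≤ M) {R U : Matrix (Fin M) (Fin M) ℂ}
    (hU : U ∈ Matrix.unitaryGroup (Fin M) ℂ) {lam : Fin M → ℝ}
    (hlam : R = U * Matrix.diagonal (fun m => (lam m : ℂ)) * Uᴴ)
    (hpos : ∀ m, 0 < lam m) {L : ℕ} {p : ℝ} (hp : 0 < p) {s : Fin M → ℝ}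
    (hs : IsSensingCentric R U L p s) :
    ∑ m, Real.logb 2 (1 + L * lam m * (p / M)) ≤ ∑ m, Real.logb 2 (1 + L * lam m * s m) := by
  have hc := const_mem_powerBudget hM hp.le
  have hmem : (precoder U fun _ => p / M)
      ∈ {W : Matrix (Fin M) (Fin M) ℂ | (W * Wᴴ).trace.re ≤ p} := by
    rw [Set.mem_ofPred_eq, trace_precoder hU hc.1]
    exact hc.2
  have h : sensingObjective R L (precoder U fun _ => p / M) ≤ sensingObjective R L (precoder U s) :=
    hs.2 hmem
  rwa [sensingObjective_precoder hU hlam hpos L hc.1,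
    sensingObjective_precoder hU hlam hpos L hs.1.1] at h

/-- Since `s i ≤ p`, no factor exceeds its uniform counterpart by more than a ratio `M`. The product
of all ratios is at least `1`, so none is below `M ^ (-M)`; hence each power grows at least linearly
in `p`. -/
lemma le_one_add_mul_of_sum_logb_le (hM : 1 ≤ M) {a s : Fin M → ℝ} (ha : ∀ m, 0 < a m) {p : ℝ}
    (hp : 0 < p) (hs : s ∈ powerBudget M p)
    (h : ∑ m, Real.logb 2 (1 + a m * (p / M)) ≤ ∑ m, Real.logb 2 (1 + a m * s m)) (m : Fin M) :
    (1 + a m * (p / M)) / M ^ M ≤ 1 + a m * s m := by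
  have hM' : (1 : ℝ) ≤ M := by exact_mod_cast hM
  have hM0 : (0 : ℝ) < M := by linarith
  have hA : ∀ i, 0 < 1 + a i * (p / M) := fun i => by
    have := ha i
    positivity
  have hB : ∀ i, 0 < 1 + a i * s i := fun i => by
    have := ha i
    have := hs.1 i
    positivity
  have hlM : 0 ≤ Real.logb 2 M := Real.logb_nonneg one_lt_two hM'
  have hother : ∀ i, Real.logb 2 (1 + a i * s i) - Real.logb 2 (1 + a i * (p / M))
      ≤ Real.logb 2 M := fun i => by
    rw [sub_le_iff_le_add, ← Real.logb_mul hM0.ne' (hA i).ne']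
    refine Real.logb_le_logb_of_le one_lt_two (hB i) ?_
    have h1 : a i * s i ≤ a i * p := mul_le_mul_of_nonneg_left (le_budget hs i) (ha i).le
    have h2 : (M : ℝ) * (1 + a i * (p / M)) = M + a i * p := by field_simp
    linarith
  have hsum : 0 ≤ ∑ i, (Real.logb 2 (1 + a i * s i) - Real.logb 2 (1 + a i * (p / M))) := by
    rw [Finset.sum_sub_distrib]
    linarith
  rw [← Finset.add_sum_erase _ _ (Finset.mem_univ m)] at hsum
  have hle : ∑ i ∈ Finset.univ.erase m,
      (Real.logb 2 (1 + a i * s i) - Real.logb 2 (1 + a i * (p / M))) ≤ M * Real.logb 2 M := by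
    refine (Finset.sum_le_sum fun i _ => hother i).trans ?_
    rw [Finset.sum_const, nsmul_eq_mul]
    gcongr
    exact_mod_cast (Finset.card_le_univ _).trans_eq (Fintype.card_fin M)
  have hfin : Real.logb 2 ((1 + a m * (p / M)) / M ^ M) ≤ Real.logb 2 (1 + a m * s m) := by
    rw [Real.logb_div (hA m).ne' (by positivity), Real.logb_pow]
    linarith
  exact (Real.logb_le_logb one_lt_two (div_pos (hA m) (by positivity)) (hB m)).1 hfin

lemma tendsto_atTop_of_sum_logb_le (hM : 1 ≤ M) {a : Fin M → ℝ} (ha : ∀ m, 0 < a m)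
    {s : ℝ → Fin M → ℝ} (hs : ∀ p, 0 < p → s p ∈ powerBudget M p)
    (h : ∀ p, 0 < p →
      ∑ m, Real.logb 2 (1 + a m * (p / M)) ≤ ∑ m, Real.logb 2 (1 + a m * s p m)) (m : Fin M) :
    Tendsto (fun p => s p m) atTop atTop := by
  have hM0 : (0 : ℝ) < M := by exact_mod_cast hM
  have ham := ha m
  have hlow : Tendsto (fun p : ℝ => ((1 + a m * (p / M)) / M ^ M - 1) / a m) atTop atTop := by
    refine Tendsto.atTop_div_const ham (tendsto_atTop_add_const_right _ _
      (Tendsto.atTop_div_const (by positivity) (tendsto_atTop_add_const_left _ _ ?_)))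
    exact Tendsto.const_mul_atTop ham (tendsto_id.atTop_div_const hM0)
  refine tendsto_atTop_mono' _ ?_ hlow
  filter_upwards [eventually_gt_atTop 0] with p hp
  have := le_one_add_mul_of_sum_logb_le hM ha hp (hs p hp) (h p hp) m
  rw [div_le_iff₀ ham]
  linarith

/-- The terms `log₂ (a m)` occur on both sides and cancel, so the eigenvalues survive only in a
correction that vanishes as the powers grow. -/
lemma sum_logb_ge_of_sum_logb_le (hM : 1 ≤ M) {a s : Fin M → ℝ} (ha : ∀ m, 0 < a m) {p : ℝ}
    (hp : 0 < p) (hs : ∀ m, 0 < s m)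
    (h : ∑ m, Real.logb 2 (1 + a m * (p / M)) ≤ ∑ m, Real.logb 2 (1 + a m * s m)) :
    M * Real.logb 2 (p / M) - ∑ m, Real.logb 2 (1 + 1 / (a m * s m)) ≤ ∑ m, Real.logb 2 (s m) := by
  have hM0 : (0 : ℝ) < M := by exact_mod_cast hM
  have hq : 0 < p / M := by positivity
  have h1 : ∑ m, Real.logb 2 (1 + a m * s m) = ∑ m, Real.logb 2 (a m) + ∑ m, Real.logb 2 (s m)
      + ∑ m, Real.logb 2 (1 + 1 / (a m * s m)) := by
    rw [← Finset.sum_add_distrib, ← Finset.sum_add_distrib]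
    refine Finset.sum_congr rfl fun m _ => ?_
    have := ha m
    have := hs m
    rw [← Real.logb_mul (by positivity) (by positivity),
      ← Real.logb_mul (by positivity) (by positivity)]
    congr 1
    field_simp
    ring
  have h2 : ∑ m, Real.logb 2 (a m) + M * Real.logb 2 (p / M)
      ≤ ∑ m, Real.logb 2 (1 + a m * (p / M)) := by
    have : (M : ℝ) * Real.logb 2 (p / M) = ∑ _m : Fin M, Real.logb 2 (p / M) := by simp
    rw [this, ← Finset.sum_add_distrib]
    refine Finset.sum_le_sum fun m _ => ?_
    rw [← Real.logb_mul (ha m).ne' hq.ne']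
    exact Real.logb_le_logb_of_le one_lt_two (mul_pos (ha m) hq) (by linarith)
  linarith

end Sensing

/-! ### Isotropic Gaussian measures via characteristic functions. -/

section ComplexGaussian

variable (V : Type*) [NormedAddCommGroup V] [InnerProductSpace ℝ V]

/-- The density of `gaussC`. -/
noncomputable def gaussDensity (x : V) : ℝ :=
  Real.pi ^ (-(Module.finrank ℝ V / 2 : ℝ)) * Real.exp (-‖x‖ ^ 2)

variable {V} in
lemma gaussDensity_pos (x : V) : 0 < gaussDensity V x := by
  have := Real.pi_pos
  unfold gaussDensity
  positivity

variable {V} in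
lemma continuous_gaussDensity : Continuous (gaussDensity V) := by
  unfold gaussDensity
  fun_prop

variable [FiniteDimensional ℝ V] [MeasurableSpace V] [BorelSpace V]

/-- The isotropic centred Gaussian law on `V` with variance `1/2` in every direction. -/
noncomputable def gaussC : Measure V :=
  volume.withDensity fun x => ENNReal.ofReal (gaussDensity V x)

variable {V}

lemma integrable_gaussC_iff {f : V → ℝ} :
    Integrable f (gaussC V) ↔ Integrable (fun x => gaussDensity V x * f x) := by
  rw [gaussC, integrable_withDensity_iff_integrable_smul'
    continuous_gaussDensity.measurable.ennreal_ofReal (by simp)]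
  simp only [ENNReal.toReal_ofReal (gaussDensity_pos _).le, smul_eq_mul]

lemma integral_gaussC {F : Type*} [NormedAddCommGroup F] [NormedSpace ℝ F] (f : V → F) :
    ∫ x, f x ∂gaussC V = ∫ x, gaussDensity V x • f x := by
  rw [gaussC, integral_withDensity_eq_integral_toReal_smul
    continuous_gaussDensity.measurable.ennreal_ofReal (by simp)]
  simp only [ENNReal.toReal_ofReal (gaussDensity_pos _).le]

lemma integral_gaussDensity : ∫ x, gaussDensity V x = 1 := by
  unfold gaussDensity
  rw [integral_const_mul]
  have := GaussianFourier.integral_rexp_neg_mul_sq_norm (V := V) one_pos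
  simp only [neg_mul, one_mul, div_one] at this
  rw [this, ← Real.rpow_add Real.pi_pos]
  simp

instance : IsProbabilityMeasure (gaussC V) := by
  refine ⟨?_⟩
  have hint : Integrable (gaussDensity V) := by
    by_contra h
    have := integral_undef h
    rw [integral_gaussDensity] at this
    exact one_ne_zero this
  rw [gaussC, withDensity_apply _ MeasurableSet.univ, Measure.restrict_univ,
    ← ofReal_integral_eq_lintegral_ofReal hint
      (Eventually.of_forall fun x => (gaussDensity_pos x).le), integral_gaussDensity,
    ENNReal.ofReal_one]

lemma charFun_gaussC (t : V) : charFun (gaussC V) t = Complex.exp (-(‖t‖ ^ 2 / 4 : ℝ)) := by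
  have h := GaussianFourier.integral_cexp_neg_mul_sq_norm_add (V := V) (b := 1) (by simp)
    Complex.I t
  rw [charFun_apply, integral_gaussC]
  have h1 : ∀ x : V, gaussDensity V x • Complex.exp ((inner ℝ x t : ℝ) * Complex.I)
      = ((Real.pi ^ (-(Module.finrank ℝ V / 2 : ℝ)) : ℝ) : ℂ) *
        Complex.exp (-1 * (‖x‖ : ℂ) ^ 2 + Complex.I * (inner ℝ t x : ℝ)) := fun x => by
    rw [gaussDensity, Complex.real_smul, Complex.exp_add, real_inner_comm]
    push_cast
    rw [mul_assoc, neg_one_mul, mul_comm Complex.I]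
  simp_rw [h1]
  rw [integral_const_mul, h, ← mul_assoc, Complex.ofReal_cpow Real.pi_pos.le, div_one]
  have h2 : (Real.pi : ℂ) ≠ 0 := by exact_mod_cast Real.pi_ne_zero
  push_cast
  rw [← Complex.cpow_add _ _ h2, neg_add_cancel, Complex.cpow_zero, one_mul, Complex.I_sq]
  congr 1
  ring

lemma gaussC_submodule {p : Submodule ℝ V} (hp : p ≠ ⊤) : gaussC V p = 0 :=
  withDensity_absolutelyContinuous _ _ (Measure.addHaar_submodule _ p hp)

variable {W : Type*} [NormedAddCommGroup W] [InnerProductSpace ℝ W] [FiniteDimensional ℝ W]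
  [MeasurableSpace W] [BorelSpace W]

/-- If `f` has an isometric adjoint `g`, the characteristic function of the image at `t` is that of
`gaussC V` at `g t`, which depends only on `‖g t‖ = ‖t‖`. This covers both unitary rotations and
coordinates of orthogonal projections. -/
lemma map_gaussC {f : V → W} (hf : Measurable f) {g : W → V}
    (hfg : ∀ x t, inner ℝ (f x) t = inner ℝ x (g t)) (hg : ∀ t, ‖g t‖ = ‖t‖) :
    (gaussC V).map f = gaussC W := by
  have : IsProbabilityMeasure ((gaussC V).map f) :=
    Measure.isProbabilityMeasure_map hf.aemeasurable
  have := FiniteDimensional.complete ℝ W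
  refine Measure.ext_of_charFun (funext fun t => ?_)
  rw [charFun_gaussC, ← hg, ← charFun_gaussC, charFun_apply, charFun_apply,
    integral_map hf.aemeasurable (by fun_prop)]
  simp_rw [hfg]

lemma map_pi_gaussC {ι : Type*} [Fintype ι] {E : ι → Type*} [∀ i, NormedAddCommGroup (E i)]
    [∀ i, InnerProductSpace ℝ (E i)] [∀ i, FiniteDimensional ℝ (E i)]
    [∀ i, MeasurableSpace (E i)] [∀ i, BorelSpace (E i)] :
    (Measure.pi fun i => gaussC (E i)).map (WithLp.toLp 2) = gaussC (PiLp 2 E) := by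
  have : IsProbabilityMeasure ((Measure.pi fun i => gaussC (E i)).map (WithLp.toLp 2)) :=
    Measure.isProbabilityMeasure_map (by fun_prop)
  refine Measure.ext_of_charFun (funext fun t => ?_)
  rw [charFun_gaussC, charFun_pi]
  simp_rw [charFun_gaussC]
  rw [← Complex.exp_sum]
  congr 1
  rw [PiLp.norm_sq_eq_of_L2, Finset.sum_div]
  push_cast
  rw [Finset.sum_neg_distrib]

lemma stdComplexGaussian_eq_gaussC : stdComplexGaussian = gaussC ℂ := by
  have hmeas : Measurable fun z : ℝ × ℝ => (⟨z.1, z.2⟩ : ℂ) :=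
    Complex.measurableEquivRealProd.symm.measurable
  have : IsProbabilityMeasure stdComplexGaussian :=
    Measure.isProbabilityMeasure_map hmeas.aemeasurable
  refine Measure.ext_of_charFun (funext fun t => ?_)
  rw [charFun_gaussC, charFun_apply, stdComplexGaussian,
    integral_map hmeas.aemeasurable (by fun_prop)]
  have h1 : ∀ z : ℝ × ℝ, Complex.exp ((inner ℝ (⟨z.1, z.2⟩ : ℂ) t : ℝ) * Complex.I)
      = Complex.exp (t.re * z.1 * Complex.I) * Complex.exp (t.im * z.2 * Complex.I) := fun z => by
    rw [← Complex.exp_add, Complex.inner]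
    congr 1
    simp
    ring
  simp_rw [h1]
  rw [integral_prod_mul (fun x : ℝ => Complex.exp (t.re * x * Complex.I))
    (fun x : ℝ => Complex.exp (t.im * x * Complex.I)), ← charFun_apply_real, ← charFun_apply_real,
    charFun_gaussianReal, charFun_gaussianReal, ← Complex.exp_add, Complex.sq_norm,
    Complex.normSq_apply]
  congr 1
  push_cast
  ring

end ComplexGaussian

/-! ### The squared norm of a Gaussian vector and the digamma function. -/

section Radial

variable {V : Type*} [NormedAddCommGroup V] [InnerProductSpace ℝ V] [FiniteDimensional ℝ V]
  [MeasurableSpace V] [BorelSpace V]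

/-- Polar coordinates, then `x = r ^ 2`, which turns the weight `r ^ (2 * d + 1) dr` into `x ^ d dx
/ 2`. -/
lemma integrable_norm_sq_gaussC_iff {d : ℕ} (hd : Module.finrank ℝ V = 2 * (d + 1)) {f : ℝ → ℝ} :
    Integrable (fun x => f (‖x‖ ^ 2)) (gaussC V) ↔
      IntegrableOn (fun x : ℝ => x ^ d * Real.exp (-x) * f x) (Set.Ioi 0) := by
  have : Nontrivial V := Module.nontrivial_of_finrank_pos (R := ℝ) (by omega)
  have hpi := Real.pi_pos
  rw [integrable_gaussC_iff]
  unfold gaussDensity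
  simp_rw [mul_assoc]
  rw [integrable_const_mul_iff (by positivity : (Real.pi ^ (-(Module.finrank ℝ V / 2 : ℝ))) ≠ 0).isUnit,
    integrable_fun_norm_addHaar (volume : Measure V) (f := fun r => Real.exp (-r ^ 2) * f (r ^ 2)),
    ← integrableOn_Ioi_comp_rpow_iff (fun x : ℝ => x ^ d * (Real.exp (-x) * f x))
      (two_ne_zero' ℝ)]
  rw [show Module.finrank ℝ V - 1 = 2 * d + 1 by omega]
  have h2 : (fun x : ℝ => (|(2 : ℝ)| * x ^ ((2 : ℝ) - 1)) •
      ((x ^ (2 : ℝ)) ^ d * (Real.exp (-x ^ (2 : ℝ)) * f (x ^ (2 : ℝ)))))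
      = fun x : ℝ => 2 * (x ^ (2 * d + 1) • (Real.exp (-x ^ 2) * f (x ^ 2))) := by
    funext x
    norm_num
    ring
  rw [h2, IntegrableOn, IntegrableOn, integrable_const_mul_iff (two_ne_zero' ℝ).isUnit]

/-- The constant, which involves the volume of the unit ball, is left implicit: testing on `f = 1`
later identifies it as `1 / Γ(d + 1)`. -/
lemma exists_integral_norm_sq_gaussC {d : ℕ} (hd : Module.finrank ℝ V = 2 * (d + 1)) :
    ∃ C : ℝ, ∀ f : ℝ → ℝ, ∫ x, f (‖x‖ ^ 2) ∂(gaussC V)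
      = C * ∫ x in Set.Ioi (0 : ℝ), x ^ d * Real.exp (-x) * f x := by
  have : Nontrivial V := Module.nontrivial_of_finrank_pos (R := ℝ) (by omega)
  refine ⟨Real.pi ^ (-(Module.finrank ℝ V / 2 : ℝ)) * (Module.finrank ℝ V *
    ((volume : Measure V).real (Metric.ball 0 1) * (1 / 2))), fun f => ?_⟩
  rw [integral_gaussC]
  unfold gaussDensity
  simp_rw [smul_eq_mul, mul_assoc]
  rw [integral_const_mul, integral_fun_norm_addHaar (volume : Measure V)
    (fun r => Real.exp (-r ^ 2) * f (r ^ 2)),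
    ← integral_comp_rpow_Ioi_of_pos (g := fun x : ℝ => x ^ d * (Real.exp (-x) * f x)) two_pos]
  rw [show Module.finrank ℝ V - 1 = 2 * d + 1 by omega]
  have h2 : (fun x : ℝ => ((2 : ℝ) * x ^ ((2 : ℝ) - 1)) •
      ((x ^ (2 : ℝ)) ^ d * (Real.exp (-x ^ (2 : ℝ)) * f (x ^ (2 : ℝ)))))
      = fun x : ℝ => 2 * (x ^ (2 * d + 1) • (Real.exp (-x ^ 2) * f (x ^ 2))) := by
    funext x
    norm_num
    ring
  rw [h2, integral_const_mul]
  simp only [nsmul_eq_mul, smul_eq_mul]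
  ring

lemma integral_Ioi_pow_mul_exp_neg (d : ℕ) :
    ∫ x in Set.Ioi (0 : ℝ), x ^ d * Real.exp (-x) = Real.Gamma (d + 1) := by
  rw [Real.Gamma_eq_integral (by positivity)]
  simp [mul_comm]

lemma integral_norm_sq_gaussC {d : ℕ} (hd : Module.finrank ℝ V = 2 * (d + 1)) (f : ℝ → ℝ) :
    ∫ x, f (‖x‖ ^ 2) ∂(gaussC V)
      = (∫ x in Set.Ioi (0 : ℝ), x ^ d * Real.exp (-x) * f x) / Real.Gamma (d + 1) := by
  obtain ⟨C, hC⟩ := exists_integral_norm_sq_gaussC hd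
  have h1 := hC fun _ => 1
  simp only [mul_one, integral_const, probReal_univ, smul_eq_mul,
    integral_Ioi_pow_mul_exp_neg] at h1
  rw [hC, eq_div_iff (Real.Gamma_pos_of_pos (by positivity)).ne', mul_right_comm, ← h1, one_mul]

/-- `Γ` is the Mellin transform of `exp (-x)`, and differentiating a Mellin transform inserts a
factor `log x`. -/
lemma integrableOn_and_hasDerivAt_Gamma (d : ℕ) :
    IntegrableOn (fun x : ℝ => x ^ d * Real.exp (-x) * Real.log x) (Set.Ioi 0) ∧
      HasDerivAt Real.Gamma (∫ x in Set.Ioi (0 : ℝ), x ^ d * Real.exp (-x) * Real.log x)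
        (d + 1) := by
  have hs : (0 : ℝ) < ((d + 1 : ℝ) : ℂ).re := by
    rw [Complex.ofReal_re]
    positivity
  have hmel := mellin_hasDerivAt_of_isBigO_rpow (E := ℂ) (a := ((d + 1 : ℝ) : ℂ).re + 1) (b := 0)
    (f := fun x => ((Real.exp (-x) : ℝ) : ℂ)) (s := ((d + 1 : ℝ) : ℂ))
    ((Continuous.continuousOn (by fun_prop)).locallyIntegrableOn measurableSet_Ioi)
    (by
      rw [← Asymptotics.isBigO_norm_left]
      simp_rw [Complex.norm_real, Asymptotics.isBigO_norm_left]
      simpa only [neg_one_mul] using (isLittleO_exp_neg_mul_rpow_atTop zero_lt_one _).isBigO)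
    (lt_add_one _)
    (by
      simp_rw [neg_zero, Real.rpow_zero]
      refine Asymptotics.isBigO_const_of_tendsto (?_ : Tendsto _ _ (𝓝 (1 : ℂ))) one_ne_zero
      rw [← Complex.ofReal_one, ← Real.exp_zero]
      exact Tendsto.mono_left (Continuous.tendsto' (by fun_prop) _ _ (by simp)) nhdsWithin_le_nhds)
    hs
  have heq : ∀ x : ℝ, (x : ℂ) ^ (((d + 1 : ℝ) : ℂ) - 1) •
      (Real.log x • ((Real.exp (-x) : ℝ) : ℂ))
      = ((x ^ d * Real.exp (-x) * Real.log x : ℝ) : ℂ) := fun x => by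
    have : ((d + 1 : ℝ) : ℂ) - 1 = (d : ℂ) := by push_cast; ring
    rw [this, Complex.cpow_natCast, Complex.real_smul]
    push_cast
    rw [smul_eq_mul]
    ring
  obtain ⟨hconv, hderiv⟩ := hmel
  constructor
  · have h : IntegrableOn _ _ volume := hconv
    simp_rw [heq] at h
    exact h.re
  · have hval : mellin (fun x => Real.log x • ((Real.exp (-x) : ℝ) : ℂ)) ((d + 1 : ℝ) : ℂ)
        = ((∫ x in Set.Ioi (0 : ℝ), x ^ d * Real.exp (-x) * Real.log x : ℝ) : ℂ) := by
      rw [mellin]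
      simp_rw [heq]
      exact integral_complex_ofReal
    rw [hval, ← Complex.GammaIntegral_eq_mellin] at hderiv
    have h2 : HasDerivAt Complex.Gamma _ ((d + 1 : ℝ) : ℂ) := hderiv.congr_of_eventuallyEq (by
      have : IsOpen {s : ℂ | 0 < s.re} := isOpen_lt continuous_const Complex.continuous_re
      filter_upwards [this.mem_nhds hs] with z hz using Complex.Gamma_eq_integral hz)
    exact h2.real_of_complex

lemma digamma_eq (d : ℕ) : digamma (d + 1)
    = (∫ x in Set.Ioi (0 : ℝ), x ^ d * Real.exp (-x) * Real.log x) / Real.Gamma (d + 1) :=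
  ((integrableOn_and_hasDerivAt_Gamma d).2.log
    (Real.Gamma_pos_of_pos (by positivity)).ne').deriv

lemma integrable_log_norm_sq_gaussC {d : ℕ} (hd : Module.finrank ℝ V = 2 * (d + 1)) :
    Integrable (fun x => Real.log (‖x‖ ^ 2)) (gaussC V) :=
  (integrable_norm_sq_gaussC_iff hd).2 (integrableOn_and_hasDerivAt_Gamma d).1

lemma integral_log_norm_sq_gaussC {d : ℕ} (hd : Module.finrank ℝ V = 2 * (d + 1)) :
    ∫ x, Real.log (‖x‖ ^ 2) ∂(gaussC V) = digamma (d + 1) := by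
  rw [digamma_eq, ← integral_norm_sq_gaussC hd]

lemma integrable_norm_sq_gaussC {d : ℕ} (hd : Module.finrank ℝ V = 2 * (d + 1)) :
    Integrable (fun x => ‖x‖ ^ 2) (gaussC V) := by
  refine (integrable_norm_sq_gaussC_iff hd (f := fun x => x)).2 ?_
  have h := Real.GammaIntegral_convergent (s := d + 2) (by positivity)
  refine h.congr_fun (fun x _ => ?_) measurableSet_Ioi
  have : (d : ℝ) + 2 - 1 = (d + 1 : ℕ) := by push_cast; ring
  simp only [this, Real.rpow_natCast]
  ring

lemma integrable_log_one_add_norm_sq_gaussC {d : ℕ} (hd : Module.finrank ℝ V = 2 * (d + 1)) :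
    Integrable (fun x => Real.log (1 + ‖x‖ ^ 2)) (gaussC V) := by
  refine (integrable_norm_sq_gaussC hd).mono' ?_ (Eventually.of_forall fun x => ?_)
  · exact (Continuous.log (by fun_prop) fun x => by positivity).aestronglyMeasurable
  · rw [Real.norm_of_nonneg (Real.log_nonneg (by nlinarith [sq_nonneg ‖x‖]))]
    have := Real.log_le_sub_one_of_pos (show 0 < 1 + ‖x‖ ^ 2 by positivity)
    linarith

lemma ae_norm_sq_pos_gaussC {d : ℕ} (hd : Module.finrank ℝ V = 2 * (d + 1)) :
    ∀ᵐ x ∂gaussC V, 0 < ‖x‖ ^ 2 := by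
  have : Nontrivial V := Module.nontrivial_of_finrank_pos (R := ℝ) (by omega)
  have h := gaussC_submodule (V := V) (p := ⊥) bot_ne_top
  filter_upwards [measure_eq_zero_iff_ae_notMem.1 h] with x hx
  have : x ≠ 0 := by simpa using hx
  positivity

end Radial

/-! ### Projections of Gaussian vectors onto complex subspaces. -/

section ComplexSubspace

variable {ι : Type*} [Fintype ι]

lemma real_inner_eq_re_inner_euclideanSpace (x y : EuclideanSpace ℂ ι) :
    inner ℝ x y = (inner ℂ x y).re := by
  simp [PiLp.inner_apply, Complex.inner, mul_comm]

lemma finrank_real_euclideanSpace (n : ℕ) :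
    Module.finrank ℝ (EuclideanSpace ℂ (Fin n)) = 2 * n := by
  rw [finrank_real_of_complex, finrank_euclideanSpace, Fintype.card_fin]

lemma gaussC_complex_submodule {F : Submodule ℂ (EuclideanSpace ℂ ι)} (hF : F ≠ ⊤) :
    gaussC (EuclideanSpace ℂ ι) F = 0 := by
  refine gaussC_submodule (p := F.restrictScalars ℝ) fun h => hF ?_
  rwa [Submodule.restrictScalars_eq_top_iff] at h

/-- In an orthonormal basis of `F` the projection becomes a map to `ℂ^n` whose adjoint, the
inclusion of `F`, is isometric. -/
lemma map_norm_sq_starProjection_gaussC (F : Submodule ℂ (EuclideanSpace ℂ ι)) {n : ℕ}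
    (hF : Module.finrank ℂ F = n) :
    (gaussC (EuclideanSpace ℂ ι)).map (fun z => ‖F.starProjection z‖ ^ 2)
      = (gaussC (EuclideanSpace ℂ (Fin n))).map (fun w => ‖w‖ ^ 2) := by
  let b : OrthonormalBasis (Fin n) ℂ F := (stdOrthonormalBasis ℂ F).reindex (finCongr hF)
  let T : EuclideanSpace ℂ ι → EuclideanSpace ℂ (Fin n) :=
    fun z => b.repr (F.orthogonalProjectionOnto z)
  have hT : Continuous T := by fun_prop
  have hmap : (gaussC (EuclideanSpace ℂ ι)).map T = gaussC (EuclideanSpace ℂ (Fin n)) := by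
    refine map_gaussC hT.measurable (g := fun t => ((b.repr.symm t : F) : EuclideanSpace ℂ ι))
      (fun z t => ?_) fun t => ?_
    · rw [real_inner_eq_re_inner_euclideanSpace, real_inner_eq_re_inner_euclideanSpace]
      congr 1
      rw [← b.repr.symm.inner_map_map, LinearIsometryEquiv.symm_apply_apply,
        Submodule.inner_orthogonalProjectionOnto_eq_of_mem_right]
    · exact b.repr.symm.norm_map t
  rw [← hmap, Measure.map_map (by fun_prop) hT.measurable]
  congr 1
  funext z
  simp only [Function.comp_apply, T, LinearIsometryEquiv.norm_map, Submodule.starProjection_apply,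
    Submodule.coe_norm]

end ComplexSubspace

/-! ### The zero-forcing gain as a squared distance, and its law. -/

section Gain

/-- Projecting `q - a • p ∈ F` onto `Fᗮ` gives `q = a • w`, with `w` the projection of `p`. Then
`inner ℂ p q = 1` forces `‖a‖ * ‖w‖ ^ 2 = 1`, so `‖q‖ = 1 / ‖w‖`. -/
lemma norm_inv_sq_eq_norm_sq_starProjection {E : Type*} [NormedAddCommGroup E]
    [InnerProductSpace ℂ E] [FiniteDimensional ℂ E] (F : Submodule ℂ E) {p q : E} {a : ℂ}
    (hq : q ∈ Fᗮ) (hpq : inner ℂ p q = 1) (hspan : q - a • p ∈ F) :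
    ‖q‖⁻¹ ^ 2 = ‖Fᗮ.starProjection p‖ ^ 2 := by
  set w := Fᗮ.starProjection p with hw
  have hqw : q = a • w := by
    have h1 : Fᗮ.starProjection (q - a • p) = 0 :=
      Submodule.starProjection_orthogonal_apply_eq_zero hspan
    rwa [map_sub, map_smul, Submodule.starProjection_eq_self_iff.2 hq, sub_eq_zero] at h1
  have h2 : inner ℂ w q = 1 := by
    rw [hw, Submodule.inner_starProjection_left_eq_right, Submodule.starProjection_eq_self_iff.2 hq,
      hpq]
  rw [hqw, inner_smul_right, inner_self_eq_norm_sq_to_K] at h2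
  have h3 : ‖a‖ * ‖w‖ ^ 2 = 1 := by
    have := congrArg norm h2
    simpa using this
  have hw0 : ‖w‖ ≠ 0 := fun h => by simp [h] at h3
  have ha0 : ‖a‖ ≠ 0 := fun h => by simp [h] at h3
  rw [hqw, norm_smul]
  field_simp
  have : (‖w‖ ^ 2) ^ 2 * ‖a‖ ^ 2 = (‖a‖ * ‖w‖ ^ 2) ^ 2 := by ring
  rw [h3] at this
  linarith [this]

/-- The matrix with columns `z`. -/
def colMatrix {K M : ℕ} (z : Fin M → EuclideanSpace ℂ (Fin K)) : Matrix (Fin K) (Fin M) ℂ :=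
  Matrix.of fun i j => z j i

variable {K M : ℕ}

lemma isUnit_conjTranspose_mul_self_colMatrix {z : Fin M → EuclideanSpace ℂ (Fin K)}
    (hz : LinearIndependent ℂ z) : IsUnit ((colMatrix z)ᴴ * colMatrix z).det := by
  have hcol : LinearIndependent ℂ (colMatrix z).col :=
    hz.map' (WithLp.linearEquiv 2 ℂ (Fin K → ℂ)).toLinearMap (LinearEquiv.ker _)
  have hpd := Matrix.PosDef.conjTranspose_mul_self _ (Matrix.mulVec_injective_iff.2 hcol)
  exact hpd.det_pos.ne'.isUnit

lemma gain_eq_gain_one (U : Matrix (Fin M) (Fin M) ℂ) (H : Matrix (Fin K) (Fin M) ℂ) (m : Fin M) :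
    gain U H m = gain 1 (H * U) m := by
  have h : (H * U) *ᵥ (1 : Matrix (Fin M) (Fin M) ℂ).col m = H *ᵥ U.col m := by
    rw [← Matrix.mulVec_mulVec]
    congr 1
    ext i
    simp [Matrix.mulVec, dotProduct, Matrix.one_apply]
  simp only [gain, equalizer, zfColumn, Matrix.mul_one, h]

lemma gain_colMatrix_eq {n : ℕ} {z : Fin (n + 1) → EuclideanSpace ℂ (Fin K)}
    (hz : LinearIndependent ℂ z) (m : Fin (n + 1)) :
    gain 1 (colMatrix z) m
      = ‖(Submodule.span ℂ (Set.range fun j => z (m.succAbove j)))ᗮ.starProjection (z m)‖ ^ 2 := by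
  set P := colMatrix z with hP
  have hunit := isUnit_conjTranspose_mul_self_colMatrix hz
  set x : Fin (n + 1) → ℂ := (Pᴴ * P)⁻¹.col m with hx
  have hq0 : zfColumn 1 P m = P *ᵥ x := by
    ext i
    simp [zfColumn, Matrix.mulVec, Matrix.mul_apply, dotProduct, hx]
  set q : EuclideanSpace ℂ (Fin K) := WithLp.toLp 2 (zfColumn 1 P m) with hq
  have hinner : ∀ i, inner ℂ (z i) q = if i = m then 1 else 0 := fun i => by
    have h1 : (Pᴴ * (P * (Pᴴ * P)⁻¹)) i m = if i = m then 1 else 0 := by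
      rw [← Matrix.mul_assoc, Matrix.mul_nonsing_inv _ hunit, Matrix.one_apply]
    rw [← h1]
    simp [hq, zfColumn, PiLp.inner_apply, Matrix.mul_apply, hP, colMatrix, mul_comm]
  have hsum : q = ∑ j, x j • z j := by
    have : q = WithLp.toLp 2 (P *ᵥ x) := by rw [hq, hq0]
    rw [this]
    ext i
    simp [Matrix.mulVec, dotProduct, hP, colMatrix, mul_comm]
  -- Zero-forcing makes the inner product of `q` with the `m`-th column equal to `1`; normalizing
  -- `q` leaves `1 / ‖q‖`.
  have hgain : gain 1 P m = ‖q‖⁻¹ ^ 2 := by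
    have h2 : star (zfColumn 1 P m) ⬝ᵥ (P *ᵥ (1 : Matrix (Fin (n + 1)) (Fin (n + 1)) ℂ).col m)
        = 1 := by
      have h3 : inner ℂ q (z m) = 1 := by
        rw [← inner_conj_symm, hinner, if_pos rfl, map_one]
      rw [← h3]
      simp [hq, PiLp.inner_apply, dotProduct, hP, colMatrix, Matrix.mulVec, Matrix.one_apply,
        mul_comm]
    rw [gain, equalizer, star_smul, smul_dotProduct, h2]
    simp [hq]
  rw [hgain]
  refine norm_inv_sq_eq_norm_sq_starProjection (a := x m) _ ?_ ?_ ?_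
  · rw [Submodule.mem_orthogonal]
    intro u hu
    induction hu using Submodule.span_induction with
    | mem u hu =>
      obtain ⟨j, rfl⟩ := hu
      simp [hinner, Fin.succAbove_ne]
    | zero => simp
    | add u v _ _ hu hv => rw [inner_add_left, hu, hv, add_zero]
    | smul c u _ hu => rw [inner_smul_left, hu, mul_zero]
  · rw [hinner, if_pos rfl]
  · rw [hsum, Fin.sum_univ_succAbove _ m, add_sub_cancel_left]
    exact Submodule.sum_mem _ fun j _ =>
      Submodule.smul_mem _ _ (Submodule.subset_span ⟨j, rfl⟩)

lemma measurable_gain_colMatrix (m : Fin M) :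
    Measurable fun z : Fin M → EuclideanSpace ℂ (Fin K) => gain 1 (colMatrix z) m := by
  have hcol : Continuous fun z : Fin M → EuclideanSpace ℂ (Fin K) => colMatrix z :=
    continuous_matrix fun i j => by
      simp only [colMatrix, Matrix.of_apply]
      fun_prop
  have hgram : Continuous fun z : Fin M → EuclideanSpace ℂ (Fin K) =>
      (colMatrix z)ᴴ * colMatrix z := hcol.matrix_conjTranspose.matrix_mul hcol
  have hinv : ∀ i j, Measurable fun z : Fin M → EuclideanSpace ℂ (Fin K) =>
      ((colMatrix z)ᴴ * colMatrix z)⁻¹ i j := fun i j => by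
    simp_rw [Matrix.inv_def, Matrix.smul_apply, Ring.inverse_eq_inv', smul_eq_mul]
    exact hgram.matrix_det.measurable.inv.mul
      (hgram.matrix_adjugate.matrix_elem i j).measurable
  have hzf : Measurable fun z : Fin M → EuclideanSpace ℂ (Fin K) =>
      zfColumn 1 (colMatrix z) m := by
    refine measurable_pi_lambda _ fun i => ?_
    simp only [zfColumn, Matrix.mul_one, Matrix.col_apply, Matrix.mul_apply (M := colMatrix _)]
    exact Finset.measurable_sum _ fun j _ =>
      (hcol.matrix_elem i j).measurable.mul (hinv j m)
  have heq : Measurable fun z : Fin M → EuclideanSpace ℂ (Fin K) =>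
      equalizer 1 (colMatrix z) m := by
    unfold equalizer
    refine Measurable.smul (Complex.measurable_ofReal.comp (Measurable.inv ?_)) hzf
    exact ((PiLp.continuous_toLp 2 _).measurable.comp hzf).norm
  have hmul : Continuous fun z : Fin M → EuclideanSpace ℂ (Fin K) =>
      colMatrix z *ᵥ (1 : Matrix (Fin M) (Fin M) ℂ).col m :=
    hcol.matrix_mulVec continuous_const
  unfold gain
  refine (Measurable.norm ?_).pow_const 2
  simp only [dotProduct, Pi.star_apply]
  exact Finset.measurable_sum _ fun i _ =>
    ((continuous_star.measurable.comp ((measurable_pi_apply i).comp heq))).mul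
      ((measurable_pi_apply i).comp hmul.measurable)

lemma linearIndependent_insertNth {V : Type*} [AddCommGroup V] [Module ℂ V] {n : ℕ}
    (m : Fin (n + 1)) (x : V) (y : Fin n → V) :
    LinearIndependent ℂ (m.insertNth x y : Fin (n + 1) → V) ↔
      LinearIndependent ℂ y ∧ x ∉ Submodule.span ℂ (Set.range y) := by
  rw [← linearIndependent_equiv (finSuccEquiv' m).symm, linearIndependent_option]
  have : ((m.insertNth x y : Fin (n + 1) → V) ∘ (finSuccEquiv' m).symm) ∘ some = y := by
    funext j
    simp
  simp [this]

lemma pi_gaussC_preimage_insertNth {n : ℕ} (m : Fin (n + 1))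
    {S : Set (Fin (n + 1) → EuclideanSpace ℂ (Fin K))} (hS : MeasurableSet S) :
    (Measure.pi fun _ => gaussC (EuclideanSpace ℂ (Fin K))) S
      = ∫⁻ y, gaussC (EuclideanSpace ℂ (Fin K)) {x | m.insertNth x y ∈ S}
        ∂(Measure.pi fun _ : Fin n => gaussC (EuclideanSpace ℂ (Fin K))) := by
  have h := (measurePreserving_piFinSuccAbove
    (fun _ : Fin (n + 1) => gaussC (EuclideanSpace ℂ (Fin K))) m).symm
  rw [← h.measure_preimage hS.nullMeasurableSet, Measure.prod_apply_symm (h.measurable hS)]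
  rfl

lemma span_range_ne_top {n : ℕ} (hn : n < K) (y : Fin n → EuclideanSpace ℂ (Fin K)) :
    Submodule.span ℂ (Set.range y) ≠ ⊤ := fun h => by
  have h1 := finrank_range_le_card (R := ℂ) y
  rw [Set.finrank, h, finrank_top, finrank_euclideanSpace, Fintype.card_fin, Fintype.card_fin] at h1
  omega

/-- By Fubini and induction: a fresh Gaussian column almost surely avoids the proper subspace
spanned by the earlier ones. -/
lemma ae_linearIndependent {n : ℕ} (hn : n ≤ K) :
    ∀ᵐ z ∂(Measure.pi fun _ : Fin n => gaussC (EuclideanSpace ℂ (Fin K))),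
      LinearIndependent ℂ z := by
  induction n with
  | zero => exact Eventually.of_forall fun z => linearIndependent_empty_type
  | succ n ih =>
    have hS : MeasurableSet {z : Fin (n + 1) → EuclideanSpace ℂ (Fin K) |
        ¬ LinearIndependent ℂ z} := isOpen_setOfPred_linearIndependent.measurableSet.compl
    rw [ae_iff, pi_gaussC_preimage_insertNth 0 hS, lintegral_eq_zero_iff' ?_]
    · filter_upwards [ih (by omega)] with y hy
      refine measure_mono_null (fun x hx => ?_)
        (gaussC_complex_submodule (span_range_ne_top (by omega : n < K) y))
      by_contra hxs
      exact hx ((linearIndependent_insertNth 0 x y).2 ⟨hy, hxs⟩)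
    · have h := (measurePreserving_piFinSuccAbove
        (fun _ : Fin (n + 1) => gaussC (EuclideanSpace ℂ (Fin K))) 0).symm
      exact (measurable_measure_prodMk_right (h.measurable hS)).aemeasurable

lemma map_gain_pi_gaussC {d : ℕ} (hd : K = d + M) (m : Fin M) :
    (Measure.pi fun _ : Fin M => gaussC (EuclideanSpace ℂ (Fin K))).map
        (fun z => gain 1 (colMatrix z) m)
      = (gaussC (EuclideanSpace ℂ (Fin (d + 1)))).map (fun w => ‖w‖ ^ 2) := by
  obtain ⟨n, rfl⟩ : ∃ n, M = n + 1 := ⟨M - 1, by have := m.pos; omega⟩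
  ext B hB
  have hmeas := measurable_gain_colMatrix (K := K) m
  rw [Measure.map_apply hmeas hB, pi_gaussC_preimage_insertNth m (hmeas hB)]
  -- Conditionally on the other columns the law of the gain is always the same, so averaging over
  -- them is trivial.
  have key : ∀ᵐ y ∂(Measure.pi fun _ : Fin n => gaussC (EuclideanSpace ℂ (Fin K))),
      gaussC (EuclideanSpace ℂ (Fin K))
        {x | m.insertNth x y ∈ (fun z => gain 1 (colMatrix z) m) ⁻¹' B}
      = (gaussC (EuclideanSpace ℂ (Fin (d + 1)))).map (fun w => ‖w‖ ^ 2) B := by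
    filter_upwards [ae_linearIndependent (by omega : n ≤ K)] with y hy
    have hfin : Module.finrank ℂ (Submodule.span ℂ (Set.range y))ᗮ = d + 1 := by
      have h1 := (Submodule.span ℂ (Set.range y)).finrank_add_finrank_orthogonal
      rw [finrank_span_eq_card hy, finrank_euclideanSpace, Fintype.card_fin, Fintype.card_fin] at h1
      omega
    rw [← map_norm_sq_starProjection_gaussC _ hfin, Measure.map_apply (by fun_prop) hB]
    refine measure_congr ?_
    have hnull := gaussC_complex_submodule (span_range_ne_top (by omega : n < K) y)
    filter_upwards [measure_eq_zero_iff_ae_notMem.1 hnull] with x hx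
    have hli := (linearIndependent_insertNth m x y).2 ⟨hy, hx⟩
    have := gain_colMatrix_eq hli m
    simp only [Fin.insertNth_apply_succAbove, Fin.insertNth_apply_same] at this
    refine propext ?_
    change gain 1 (colMatrix (m.insertNth x y)) m ∈ B ↔ _ ∈ B
    rw [this]
  rw [lintegral_congr_ae key, lintegral_const, measure_univ, mul_one]

end Gain

/-! ### From i.i.d. entries to the law of the gains. -/

section Rayleigh

variable {K M : ℕ}

lemma sum_norm_sq_unitary_mulVec {U : Matrix (Fin M) (Fin M) ℂ}
    (hU : U ∈ Matrix.unitaryGroup (Fin M) ℂ) (v : Fin M → ℂ) :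
    ∑ l, ‖(U *ᵥ v) l‖ ^ 2 = ∑ l, ‖v l‖ ^ 2 := by
  have hU' : Uᴴ * U = 1 := Matrix.mem_unitaryGroup_iff'.1 hU
  have hdot : ∀ x : Fin M → ℂ, ((∑ l, ‖x l‖ ^ 2 : ℝ) : ℂ) = star x ⬝ᵥ x := fun x => by
    rw [dotProduct, Complex.ofReal_sum]
    refine Finset.sum_congr rfl fun l _ => ?_
    rw [Pi.star_apply, Complex.ofReal_pow, ← Complex.conj_mul']
    rfl
  rw [← Complex.ofReal_inj, hdot, hdot, Matrix.star_mulVec, Matrix.dotProduct_mulVec,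
    Matrix.vecMul_vecMul, hU', Matrix.vecMul_one]

/-- Right multiplication by `U`, from the entries of a matrix to the columns of the product. -/
noncomputable def entriesToCols (U : Matrix (Fin M) (Fin M) ℂ)
    (h : EuclideanSpace ℂ (Fin K × Fin M)) : PiLp 2 fun _ : Fin M => EuclideanSpace ℂ (Fin K) :=
  WithLp.toLp 2 fun j => WithLp.toLp 2 fun i => ∑ l, h (i, l) * U l j

lemma continuous_entriesToCols (U : Matrix (Fin M) (Fin M) ℂ) :
    Continuous (entriesToCols U : EuclideanSpace ℂ (Fin K × Fin M) → _) := by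
  unfold entriesToCols
  fun_prop

lemma map_entriesToCols_gaussC {U : Matrix (Fin M) (Fin M) ℂ}
    (hU : U ∈ Matrix.unitaryGroup (Fin M) ℂ) :
    (gaussC (EuclideanSpace ℂ (Fin K × Fin M))).map (entriesToCols U)
      = gaussC (PiLp 2 fun _ : Fin M => EuclideanSpace ℂ (Fin K)) := by
  refine map_gaussC (continuous_entriesToCols U).measurable
    (g := fun t => WithLp.toLp 2 fun il => ∑ j, t j il.1 * star (U il.2 j)) (fun h t => ?_)
    fun t => ?_
  · have hmul : ∀ a u b : ℂ, inner ℝ (a * u) b = (inner ℝ a (b * star u) : ℝ) := fun a u b => by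
      rw [Complex.inner, Complex.inner, map_mul, Complex.star_def]
      congr 1
      ring
    simp only [PiLp.inner_apply, entriesToCols, sum_inner, inner_sum, hmul, Fintype.sum_prod_type]
    rw [Finset.sum_comm]
    exact Finset.sum_congr rfl fun i _ => Finset.sum_comm
  · refine (sq_eq_sq₀ (norm_nonneg _) (norm_nonneg _)).1 ?_
    simp only [PiLp.norm_sq_eq_of_L2, Fintype.sum_prod_type]
    rw [Finset.sum_comm (γ := Fin M) (s := (Finset.univ : Finset (Fin M)))]
    refine Finset.sum_congr rfl fun i _ => ?_
    -- After conjugation, the adjoint acts on each row `i` as multiplication by `U`.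
    have h1 := sum_norm_sq_unitary_mulVec hU fun j => star (t j i)
    simp only [norm_star] at h1
    rw [← h1]
    refine Finset.sum_congr rfl fun l _ => ?_
    rw [← norm_star]
    congr 2
    simp [Matrix.mulVec, dotProduct, mul_comm]

variable {Ω : Type*} [MeasurableSpace Ω] {μ : Measure Ω}

lemma IsRayleigh.hasLaw_columns_mul {H : Ω → Matrix (Fin K) (Fin M) ℂ} (hH : IsRayleigh μ H)
    {U : Matrix (Fin M) (Fin M) ℂ} (hU : U ∈ Matrix.unitaryGroup (Fin M) ℂ) :
    HasLaw (fun ω (j : Fin M) => (WithLp.toLp 2 fun i => (H ω * U) i j : EuclideanSpace ℂ (Fin K)))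
      (Measure.pi fun _ : Fin M => gaussC (EuclideanSpace ℂ (Fin K))) μ := by
  have hX : HasLaw (fun ω (ij : Fin K × Fin M) => H ω ij.1 ij.2)
      (Measure.pi fun _ : Fin K × Fin M => gaussC ℂ) μ := by
    have hae : ∀ ij : Fin K × Fin M, AEMeasurable (fun ω => H ω ij.1 ij.2) μ :=
      fun ij => (hH.1 ij.1 ij.2).aemeasurable
    refine ⟨aemeasurable_pi_lambda _ hae, ?_⟩
    rw [hH.2.map_fun_eq_pi_map hae]
    congr 1
    funext ij
    rw [(hH.1 ij.1 ij.2).map_eq, stdComplexGaussian_eq_gaussC]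
  have h1 : HasLaw (WithLp.toLp 2) (gaussC (EuclideanSpace ℂ (Fin K × Fin M)))
      (Measure.pi fun _ : Fin K × Fin M => gaussC ℂ) :=
    ⟨by fun_prop, map_pi_gaussC⟩
  have h2 : HasLaw (entriesToCols U)
      (gaussC (PiLp 2 fun _ : Fin M => EuclideanSpace ℂ (Fin K)))
      (gaussC (EuclideanSpace ℂ (Fin K × Fin M))) :=
    ⟨(continuous_entriesToCols U).aemeasurable, map_entriesToCols_gaussC hU⟩
  have h3 : HasLaw WithLp.ofLp (Measure.pi fun _ : Fin M => gaussC (EuclideanSpace ℂ (Fin K)))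
      (gaussC (PiLp 2 fun _ : Fin M => EuclideanSpace ℂ (Fin K))) := by
    refine ⟨by fun_prop, ?_⟩
    rw [← map_pi_gaussC, Measure.map_map (by fun_prop) (by fun_prop)]
    exact Measure.map_id
  exact h3.comp (h2.comp (h1.comp hX))

lemma IsRayleigh.hasLaw_gain {H : Ω → Matrix (Fin K) (Fin M) ℂ} (hH : IsRayleigh μ H)
    {U : Matrix (Fin M) (Fin M) ℂ} (hU : U ∈ Matrix.unitaryGroup (Fin M) ℂ) {d : ℕ}
    (hd : K = d + M) (m : Fin M) :
    HasLaw (fun ω => gain U (H ω) m)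
      ((gaussC (EuclideanSpace ℂ (Fin (d + 1)))).map fun w => ‖w‖ ^ 2) μ := by
  have h1 : HasLaw (fun z => gain 1 (colMatrix z) m)
      ((gaussC (EuclideanSpace ℂ (Fin (d + 1)))).map fun w => ‖w‖ ^ 2)
      (Measure.pi fun _ : Fin M => gaussC (EuclideanSpace ℂ (Fin K))) :=
    ⟨(measurable_gain_colMatrix m).aemeasurable, map_gain_pi_gaussC hd m⟩
  refine (h1.comp (hH.hasLaw_columns_mul hU)).congr (Eventually.of_forall fun ω => ?_)
  exact gain_eq_gain_one U (H ω) m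

variable {X : Ω → ℝ} {d : ℕ}

lemma ae_pos_of_hasLaw
    (hX : HasLaw X ((gaussC (EuclideanSpace ℂ (Fin (d + 1)))).map fun w => ‖w‖ ^ 2) μ) :
    ∀ᵐ ω ∂μ, 0 < X ω := by
  have h : ∀ᵐ x ∂μ.map X, 0 < x := by
    rw [hX.map_eq, ae_map_iff (by fun_prop) measurableSet_Ioi]
    exact ae_norm_sq_pos_gaussC (finrank_real_euclideanSpace _)
  exact ae_of_ae_map hX.aemeasurable h

lemma integrable_logb_of_hasLaw
    (hX : HasLaw X ((gaussC (EuclideanSpace ℂ (Fin (d + 1)))).map fun w => ‖w‖ ^ 2) μ) :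
    Integrable (fun ω => Real.logb 2 (X ω)) μ := by
  have h : Integrable Real.log (μ.map X) := by
    rw [hX.map_eq, integrable_map_measure Real.measurable_log.aestronglyMeasurable (by fun_prop)]
    exact integrable_log_norm_sq_gaussC (finrank_real_euclideanSpace _)
  exact (h.comp_aemeasurable hX.aemeasurable).div_const _

lemma integral_logb_of_hasLaw
    (hX : HasLaw X ((gaussC (EuclideanSpace ℂ (Fin (d + 1)))).map fun w => ‖w‖ ^ 2) μ) :
    ∫ ω, Real.logb 2 (X ω) ∂μ = digamma (d + 1) / Real.log 2 := by
  simp only [Real.logb]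
  rw [integral_div, ← integral_log_norm_sq_gaussC (finrank_real_euclideanSpace (d + 1)),
    ← integral_map (φ := fun w : EuclideanSpace ℂ (Fin (d + 1)) => ‖w‖ ^ 2) (by fun_prop)
      Real.measurable_log.aestronglyMeasurable, ← hX.map_eq,
    integral_map hX.aemeasurable Real.measurable_log.aestronglyMeasurable]

lemma integrable_logb_one_add_of_hasLaw
    (hX : HasLaw X ((gaussC (EuclideanSpace ℂ (Fin (d + 1)))).map fun w => ‖w‖ ^ 2) μ) :
    Integrable (fun ω => Real.logb 2 (1 + X ω)) μ := by
  have hm : Measurable fun x : ℝ => Real.log (1 + x) := by fun_prop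
  have h : Integrable (fun x => Real.log (1 + x)) (μ.map X) := by
    rw [hX.map_eq, integrable_map_measure hm.aestronglyMeasurable (by fun_prop)]
    exact integrable_log_one_add_norm_sq_gaussC (finrank_real_euclideanSpace _)
  exact (h.comp_aemeasurable hX.aemeasurable).div_const _

end Rayleigh

end ISAC

/-! ### The main theorem. -/

theorem theorem4 {Ω : Type*} [MeasurableSpace Ω] (μ : Measure Ω) [IsProbabilityMeasure μ]
    (K M L : ℕ) (hM : 1 ≤ M) (hK : M ≤ K) (hL : 1 ≤ L)
    -- the users' channels, Rayleigh fading
    (H : Fin M → Ω → Matrix (Fin K) (Fin M) ℂ) (hH : ∀ m, ISAC.IsRayleigh μ (H m))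
    -- the target correlation matrix and an eigendecomposition of it
    (R U : Matrix (Fin M) (Fin M) ℂ) (hR : R.PosDef) (hU : U ∈ Matrix.unitaryGroup (Fin M) ℂ)
    (lam : Fin M → ℝ) (hlam : R = U * Matrix.diagonal (fun m => (lam m : ℂ)) * Uᴴ)
    -- the random gains
    (ρ : Ω → Fin M → ℝ) (hρ : ∀ ω m, ρ ω m = ISAC.gain U (H m ω) m) :
    -- almost surely water-filling over the gains attains the maximum sum rate
    (∀ᵐ ω ∂μ, (∀ m, 0 < ρ ω m) ∧ ∀ p : ℝ, 0 < p →
      (∃ υ : ℝ, 0 < υ ∧ ∑ m, ISAC.waterFilling υ (ρ ω) m = p) ∧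
      ∀ υ : ℝ, 0 < υ → ∑ m, ISAC.waterFilling υ (ρ ω) m = p →
        IsGreatest (ISAC.achievableRates p (ρ ω))
          (ISAC.sumRate (ISAC.waterFilling υ (ρ ω)) (ρ ω))) ∧
    -- the sum ergodic rate of the communications-centric design and its high-SNR behaviour
    (∀ p : ℝ, 0 < p → Integrable (fun ω => ISAC.ccSumRate p (ρ ω)) μ) ∧
    Tendsto (fun p : ℝ => (∫ ω, ISAC.ccSumRate p (ρ ω) ∂μ) - ISAC.highSNR K M p)
      atTop (𝓝 0) ∧
    -- the sensing-centric design has the same high-SNR behaviour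
    (∀ s : ℝ → Fin M → ℝ, (∀ p : ℝ, 0 < p → ISAC.IsSensingCentric R U L p (s p)) →
      (∀ p : ℝ, 0 < p → Integrable (fun ω => ISAC.sumRate (s p) (ρ ω)) μ) ∧
      Tendsto (fun p : ℝ => (∫ ω, ISAC.sumRate (s p) (ρ ω) ∂μ) - ISAC.highSNR K M p)
        atTop (𝓝 0)) := by
  -- `d` is `K'` as a natural number, so the digamma argument is `d + 1`.
  obtain ⟨d, hd⟩ : ∃ d, K = d + M := ⟨K - M, by omega⟩
  have hlaw : ∀ m, HasLaw (fun ω => ρ ω m)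
      ((ISAC.gaussC (EuclideanSpace ℂ (Fin (d + 1)))).map fun w => ‖w‖ ^ 2) μ := fun m => by
    simp only [hρ]
    exact (hH m).hasLaw_gain hU hd m
  have hmeas : ∀ m, AEMeasurable (fun ω => ρ ω m) μ := fun m => (hlaw m).aemeasurable
  have hnn : ∀ ω m, 0 ≤ ρ ω m := fun ω m => by
    rw [hρ, ISAC.gain]
    positivity
  have hpos : ∀ᵐ ω ∂μ, ∀ m, 0 < ρ ω m := ae_all_iff.2 fun m => ISAC.ae_pos_of_hasLaw (hlaw m)
  have hint := fun m => ISAC.integrable_logb_one_add_of_hasLaw (hlaw m)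
  have hlog := fun m => ISAC.integrable_logb_of_hasLaw (hlaw m)
  have hsnr : ∀ p : ℝ, 0 < p → M * Real.logb 2 (p / M) + ∑ m, ∫ ω, Real.logb 2 (ρ ω m) ∂μ
      = ISAC.highSNR K M p := fun p hp => by
    have hM0 : (M : ℝ) ≠ 0 := by
      have : M ≠ 0 := by omega
      exact_mod_cast this
    simp only [ISAC.integral_logb_of_hasLaw (hlaw _)]
    rw [ISAC.highSNR, Real.logb_div hp.ne' hM0, hd, Nat.cast_add, add_sub_cancel_right,
      Finset.sum_const, Finset.card_univ, Fintype.card_fin, nsmul_eq_mul]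
    ring
  refine ⟨?_, fun p hp => ISAC.integrable_ccSumRate hmeas hnn hint hp, ?_, fun s hs => ⟨?_, ?_⟩⟩
  · filter_upwards [hpos] with ω hω
    exact ⟨hω, fun p hp => ⟨ISAC.exists_sum_waterFilling_eq hM hω hp,
      fun υ hυ h => ISAC.isGreatest_sumRate_waterFilling hω hυ h⟩⟩
  · refine (ISAC.tendsto_integral_ccSumRate_sub hM hmeas hnn hpos hint hlog).congr' ?_
    filter_upwards [eventually_gt_atTop 0] with p hp
    rw [hsnr p hp]
  · exact fun p hp => ISAC.integrable_sumRate hmeas hnn hint (hs p hp).1.1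
  · have hlampos := ISAC.eigenvalue_pos hR hU hlam
    have ha : ∀ m, 0 < (L : ℝ) * lam m := fun m =>
      mul_pos (by exact_mod_cast hL) (hlampos m)
    have hle := fun p (hp : 0 < p) => (hs p hp).sum_logb_le hM hU hlam hlampos hp
    have htop := ISAC.tendsto_atTop_of_sum_logb_le hM ha (fun p hp => (hs p hp).1) hle
    have hspos : ∀ᶠ p in atTop, ∀ m, 0 < s p m :=
      eventually_all.2 fun m => (htop m).eventually_gt_atTop 0
    have hε : Tendsto (fun p => ∑ m, Real.logb 2 (1 + 1 / (L * lam m * s p m))) atTop (𝓝 0) := by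
      have h : ∀ m, Tendsto (fun p => Real.logb 2 (1 + 1 / (L * lam m * s p m))) atTop
          (𝓝 (Real.logb 2 (1 + 0))) := fun m =>
        Tendsto.div_const (Tendsto.log (Tendsto.const_add _
          (tendsto_const_nhds.div_atTop ((htop m).const_mul_atTop (ha m)))) (by norm_num)) _
      simpa using tendsto_finsetSum Finset.univ fun m _ => h m
    refine (ISAC.tendsto_integral_sumRate_sub hM hmeas hnn hpos hint hlog
      (fun p hp => (hs p hp).1) hε hspos ?_).congr' ?_
    · filter_upwards [hspos, eventually_gt_atTop 0] with p h1 hp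
      exact ISAC.sum_logb_ge_of_sum_logb_le hM ha hp h1 (hle p hp)
    · filter_upwards [eventually_gt_atTop 0] with p hp
      rw [hsnr p hp]
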